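/- Let $m,n$ be positive integers, write $R^{(m,n)}$ for the set of $m\times n$ matrices over $R$ and $\sigma$ for the trace, and let $\mathcal M$ be a positive definite symmetric integral unimodular $m\times m$ matrix with $\mathcal M\,\mathbb Z^{(m,n)}=\mathbb Z^{(m,n)}$. Put $(x,y)_{\mathcal M}=\sigma({}^t x\mathcal M y)$ and $\|x\|_{\mathcal M}^2=(x,x)_{\mathcal M}$. For a Schwartz function $f$ on $\mathbb R^{(m,n)}$ and $\phi\in\mathbb R$ let $[R_{\mathcal M}(i,\phi)f](x)=f(x)$ if $\phi\equiv0 \pmod{2\pi}$, $[R_{\mathcal M}(i,\phi)f](x)=f(-x)$ if $\phi\equiv\pi\pmod{2\pi}$, and otherwise $$[R_{\mathcal M}(i,\phi)f](x)=(\det\mathcal M)^{n/2}|\sin\phi|^{-mn/2}\int_{\mathbb R^{(m,n)}}\exp\Big(\pi i\,\frac{(\|x\|_{\mathcal M}^2+\|y\|_{\mathcal M}^2)\cos\phi-2(x,y)_{\mathcal M}}{\sin\phi}\Big)f(y)\,dy .$$ For $\tau=u+iv$ in the upper half plane, $\phi\in\mathbb R$ and $\lambda,\mu\in\mathbb R^{(m,n)}$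 let $$\Theta_f^{[\mathcal M]}(\tau,\phi;\lambda,\mu)=v^{mn/4}\sum_{\omega\in\mathbb Z^{(m,n)}}e^{\pi i\{u\|\omega+\lambda\|_{\mathcal M}^2+2(\omega,\mu)_{\mathcal M}\}}\,[R_{\mathcal M}(i,\phi)f]\big(v^{1/2}(\omega+\lambda)\big).$$ Let $G^{(m,n)}=SL(2,\mathbb R)\ltimes(\mathbb R^{(m,n)}\times\mathbb R^{(m,n)})$ with the law $(g_1,(\lambda_1,\mu_1))(g_2,(\lambda_2,\mu_2))=(g_1g_2,(\lambda_1,\mu_1)g_2+(\lambda_2,\mu_2))$, where $(\lambda,\mu)\begin{pmatrix}a&b\\c&d\end{pmatrix}=(a\lambda+c\mu,\,b\lambda+d\mu)$. The element of $G^{(m,n)}$ with coordinates $(\tau,\phi;\lambda,\mu)$, where $0\le\phi<2\pi$, is $(I_2,(\lambda,\mu))\cdot((\tau,\phi),(0,0))$, where $(\tau,\phi)$ denotes the matrix $$\begin{pmatrix}1&u\\0&1\end{pmatrix}\begin{pmatrix}v^{1/2}&0\\0&v^{-1/2}\end{pmatrix}\begin{pmatrix}\cos\phi&-\sin\phi\\\sin\phi&\cos\phi\end{pmatrix};$$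 thus $\Theta_f^{[\mathcal M]}$ becomes a function on $G^{(m,n)}$. Let $\Gamma^{(m,n)}_{[2]}$ be the subgroup of the group of integral points $SL(2,\mathbb Z)\ltimes(\mathbb Z^{(m,n)}\times\mathbb Z^{(m,n)})$ of $G^{(m,n)}$ generated by the elements $$(S,(0,0)),\qquad (T_*,(0,s)),\qquad (I_2,(\lambda_0,\mu_0))\qquad (s,\lambda_0,\mu_0\in\mathbb Z^{(m,n)}),$$ where $S=\begin{pmatrix}0&-1\\1&0\end{pmatrix}$ and $T_*=\begin{pmatrix}1&2\\0&1\end{pmatrix}$. **Theorem 3.4.** For all Schwartz functions $f,g$ on $\mathbb R^{(m,n)}$, the series defining $\Theta_f^{[\mathcal M]}$ and $\Theta_g^{[\mathcal M]}$ converge absolutely, and the function $$\Theta_f^{[\mathcal M]}(\tau,\phi;\lambda,\mu)\;\overline{\Theta_g^{[\mathcal M]}(\tau,\phi;\lambda,\mu)}$$ on $G^{(m,n)}$ is invariant under the action of $\Gamma^{(m,n)}_{[2]}$ on $G^{(m,n)}$ by left multiplication. -/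

import Mathlib

open scoped MatrixGroups SchwartzMap UpperHalfPlane

-- Any norm on real matrices gives the same Schwartz space; we use the entrywise sup norm.
attribute [local instance] Matrix.normedAddCommGroup Matrix.normedSpace

namespace ThetaSum

/-- The space `R^{(m,n)}` of `m × n` matrices. -/
abbrev Mat (m n : ℕ) (R : Type) := Matrix (Fin m) (Fin n) R

/-- The right action `(λ, μ) ↦ (λ, μ) g = (aλ + cμ, bλ + dμ)` of `g = (a b; c d)` in `SL(2,R)`. -/
def pairMul {m n : ℕ} {R : Type} [CommRing R] (p : Mat m n R × Mat m n R) (g : SL(2, R)) :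
    Mat m n R × Mat m n R :=
  (g 0 0 • p.1 + g 1 0 • p.2, g 0 1 • p.1 + g 1 1 • p.2)

/-- The underlying set of `SL(2,R) ⋉ (R^{(m,n)} × R^{(m,n)})`. For `R = ℝ` this is `G^{(m,n)}`,
for `R = ℤ` it is its group `Γ^{(m,n)}` of integral points. -/
@[ext]
structure JacobiGroup (m n : ℕ) (R : Type) [CommRing R] where
  /-- the component in `SL(2,R)` -/
  sl : SL(2, R)
  /-- the component `(λ, μ)` -/
  vec : Mat m n R × Mat m n R

section group
variable {m n : ℕ} {R : Type} [CommRing R]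

theorem pairMul_one (p : Mat m n R × Mat m n R) : pairMul p 1 = p := by
  simp [pairMul]

theorem pairMul_mul (p : Mat m n R × Mat m n R) (g h : SL(2, R)) :
    pairMul p (g * h) = pairMul (pairMul p g) h := by
  ext i j <;>
  simp [pairMul, Matrix.mul_apply, Fin.sum_univ_two] <;> ring

theorem pairMul_add (p q : Mat m n R × Mat m n R) (g : SL(2, R)) :
    pairMul (p + q) g = pairMul p g + pairMul q g := by
  ext i j <;> simp [pairMul] <;> ring

theorem pairMul_neg (p : Mat m n R × Mat m n R) (g : SL(2, R)) :
    pairMul (-p) g = -pairMul p g := by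
  ext i j <;> simp [pairMul] <;> ring

theorem pairMul_zero (g : SL(2, R)) : pairMul (0 : Mat m n R × Mat m n R) g = 0 := by
  ext i j <;> simp [pairMul]

/-- `(g₁, (λ₁, μ₁)) (g₂, (λ₂, μ₂)) = (g₁ g₂, (λ₁, μ₁) g₂ + (λ₂, μ₂))`. -/
instance : Mul (JacobiGroup m n R) :=
  ⟨fun x y => ⟨x.sl * y.sl, pairMul x.vec y.sl + y.vec⟩⟩

instance : One (JacobiGroup m n R) := ⟨⟨1, 0⟩⟩

instance : Inv (JacobiGroup m n R) := ⟨fun x => ⟨x.sl⁻¹, -pairMul x.vec x.sl⁻¹⟩⟩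

theorem mul_def (x y : JacobiGroup m n R) :
    x * y = ⟨x.sl * y.sl, pairMul x.vec y.sl + y.vec⟩ := rfl

theorem one_def : (1 : JacobiGroup m n R) = ⟨1, 0⟩ := rfl

theorem inv_def (x : JacobiGroup m n R) : x⁻¹ = ⟨x.sl⁻¹, -pairMul x.vec x.sl⁻¹⟩ := rfl

instance : Group (JacobiGroup m n R) :=
  Group.ofLeftAxioms
    (fun x y z => by
      simp only [mul_def, mul_assoc, pairMul_mul, pairMul_add, add_assoc])
    (fun x => by simp [mul_def, one_def, pairMul_zero])
    (fun x => by
      simp [mul_def, one_def, inv_def, pairMul_neg, ← pairMul_mul, pairMul_one])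

end group

/-- The map `Γ^{(m,n)} → G^{(m,n)}` regarding an integral element as a real one. -/
def toReal {m n : ℕ} (x : JacobiGroup m n ℤ) : JacobiGroup m n ℝ :=
  ⟨x.sl.map (Int.castRingHom ℝ),
    (x.vec.1.map (Int.cast : ℤ → ℝ), x.vec.2.map (Int.cast : ℤ → ℝ))⟩

/-- `toReal` is multiplicative, so `γ · x = toReal γ * x` is an action of the integral group. -/
theorem toReal_mul {m n : ℕ} (x y : JacobiGroup m n ℤ) :
    toReal (x * y) = toReal x * toReal y := by
  apply JacobiGroup.ext
  · simp [toReal, mul_def]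
  · ext i j <;> simp [toReal, mul_def, pairMul]

/-- `S = (0 -1; 1 0)`. -/
def matS : SL(2, ℤ) := ⟨!![0, -1; 1, 0], by simp⟩

/-- `T_* = (1 2; 0 1)`. -/
def matTstar : SL(2, ℤ) := ⟨!![1, 2; 0, 1], by simp⟩

/-- The subgroup `Γ_{[2]}^{(m,n)}` of `Γ^{(m,n)}` generated by `(S, (0,0))`, all `(T_*, (0,s))`
and all `(I₂, (λ₀, μ₀))` with `s, λ₀, μ₀` integral. -/
def Gamma2 (m n : ℕ) : Subgroup (JacobiGroup m n ℤ) :=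
  Subgroup.closure
    ({⟨matS, (0, 0)⟩} ∪
      Set.range (fun s : Mat m n ℤ => (⟨matTstar, (0, s)⟩ : JacobiGroup m n ℤ)) ∪
      Set.range (fun p : Mat m n ℤ × Mat m n ℤ => (⟨1, p⟩ : JacobiGroup m n ℤ)))

noncomputable section

/-- `(x, y)_M = tr(ᵗx M y)`; in particular `form M x x = ‖x‖_M²`. -/
def form {m n : ℕ} (M : Matrix (Fin m) (Fin m) ℝ) (x y : Mat m n ℝ) : ℝ :=
  Matrix.trace (x.transpose * M * y)

open Classical in
/-- The operator `R_M(i, φ)` of the (projective) Weil representation. The integral is with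
respect to Lebesgue measure on the `mn` entries of `y`. -/
def weilRot {m n : ℕ} (M : Matrix (Fin m) (Fin m) ℝ) (φ : ℝ) (f : Mat m n ℝ → ℂ)
    (x : Mat m n ℝ) : ℂ :=
  if ∃ k : ℤ, φ = 2 * Real.pi * k then f x
  else if ∃ k : ℤ, φ = Real.pi + 2 * Real.pi * k then f (-x)
  else
    ((M.det ^ ((n : ℝ) / 2) * |Real.sin φ| ^ (-((m : ℝ) * n / 2)) : ℝ) : ℂ) *
      ∫ y : Fin m → Fin n → ℝ,
        Complex.exp
          (((((form M x x + form M (Matrix.of y) (Matrix.of y)) * Real.cos φ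
              - 2 * form M x (Matrix.of y)) / Real.sin φ : ℝ) : ℂ) * Real.pi * Complex.I) *
          f (Matrix.of y)

/-- The summand, indexed by `ω ∈ ℤ^{(m,n)}`, of the series for `Θ_f^{[M]}(τ, φ; λ, μ)`. -/
def thetaTerm {m n : ℕ} (M : Matrix (Fin m) (Fin m) ℝ) (f : Mat m n ℝ → ℂ)
    (τ : ℍ) (φ : ℝ) (lam mu : Mat m n ℝ) (ω : Mat m n ℤ) : ℂ :=
  Complex.exp
      (Real.pi * Complex.I *
        ((τ.re * form M (ω.map (Int.cast : ℤ → ℝ) + lam) (ω.map (Int.cast : ℤ → ℝ) + lam)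
          + 2 * form M (ω.map (Int.cast : ℤ → ℝ)) mu : ℝ) : ℂ)) *
    weilRot M φ f (Real.sqrt τ.im • (ω.map (Int.cast : ℤ → ℝ) + lam))

/-- The theta sum `Θ_f^{[M]}(τ, φ; λ, μ)`, with `τ = u + iv`. -/
def theta {m n : ℕ} (M : Matrix (Fin m) (Fin m) ℝ) (f : Mat m n ℝ → ℂ)
    (τ : ℍ) (φ : ℝ) (lam mu : Mat m n ℝ) : ℂ :=
  ((τ.im ^ ((m : ℝ) * n / 4) : ℝ) : ℂ) * ∑' ω : Mat m n ℤ, thetaTerm M f τ φ lam mu ω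

/-- The Iwasawa coordinate `τ = g · i` of `g ∈ SL(2,ℝ)`. -/
def iwasawaTau (g : SL(2, ℝ)) : ℍ := g • UpperHalfPlane.I

/-- The Iwasawa coordinate `φ ∈ [0, 2π)` of `g = (a b; c d)`: the argument of `d + ic`. -/
def iwasawaPhi (g : SL(2, ℝ)) : ℝ :=
  toIcoMod Real.two_pi_pos 0 (Complex.arg (⟨g 1 1, g 1 0⟩ : ℂ))

/-- The two coordinates are those of the Iwasawa decomposition. -/
theorem iwasawa_decomposition (g : SL(2, ℝ)) :
    (g : Matrix (Fin 2) (Fin 2) ℝ) =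
      !![1, (iwasawaTau g).re; 0, 1] *
      !![Real.sqrt (iwasawaTau g).im, 0; 0, (Real.sqrt (iwasawaTau g).im)⁻¹] *
      !![Real.cos (iwasawaPhi g), -Real.sin (iwasawaPhi g);
         Real.sin (iwasawaPhi g), Real.cos (iwasawaPhi g)] := by
  have hdet : g 0 0 * g 1 1 - g 0 1 * g 1 0 = 1 := by
    have h := g.det_coe
    rwa [Matrix.det_fin_two] at h
  set a := g 0 0
  set b := g 0 1
  set c := g 1 0
  set d := g 1 1
  have hN : 0 < c ^ 2 + d ^ 2 := by
    by_contra h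
    have hc : c = 0 := by nlinarith [sq_nonneg c, sq_nonneg d]
    have hd : d = 0 := by nlinarith [sq_nonneg c, sq_nonneg d]
    simp [hc, hd] at hdet
  have hz : (⟨d, c⟩ : ℂ) ≠ 0 := by
    intro h
    have h1 := congrArg Complex.re h
    have h2 := congrArg Complex.im h
    simp at h1 h2
    simp [h1, h2] at hN
  have hnorm : ‖(⟨d, c⟩ : ℂ)‖ = Real.sqrt (c ^ 2 + d ^ 2) := by
    rw [Complex.norm_def, Complex.normSq_apply]
    congr 1
    ring
  have hτ : ((iwasawaTau g : ℍ) : ℂ) = (a * Complex.I + b) / (c * Complex.I + d) := by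
    rw [iwasawaTau, UpperHalfPlane.specialLinearGroup_apply]
    simp [a, b, c, d]
  have hden : (c * Complex.I + d : ℂ) ≠ 0 := by
    intro h
    apply hz
    rw [← h]
    apply Complex.ext <;> simp
  have hτ' : ((iwasawaTau g : ℍ) : ℂ) =
      ⟨(a * c + b * d) / (c ^ 2 + d ^ 2), 1 / (c ^ 2 + d ^ 2)⟩ := by
    rw [hτ, div_eq_iff hden]
    apply Complex.ext
    · simp
      field_simp
      linear_combination (-c) * hdet
    · simp
      field_simp
      linear_combination d * hdet
  have hre : (iwasawaTau g).re = (a * c + b * d) / (c ^ 2 + d ^ 2) :=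
    congrArg Complex.re hτ'
  have him : (iwasawaTau g).im = 1 / (c ^ 2 + d ^ 2) :=
    congrArg Complex.im hτ'
  have hφ : ∃ k : ℤ, iwasawaPhi g = Complex.arg ⟨d, c⟩ - k * (2 * Real.pi) := by
    refine ⟨toIcoDiv Real.two_pi_pos 0 (Complex.arg ⟨d, c⟩), ?_⟩
    rw [iwasawaPhi, toIcoMod, zsmul_eq_mul]
  obtain ⟨k, hk⟩ := hφ
  have hcos : Real.cos (iwasawaPhi g) = d / Real.sqrt (c ^ 2 + d ^ 2) := by
    rw [hk, Real.cos_sub_int_mul_two_pi, Complex.cos_arg hz, hnorm]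
  have hsin : Real.sin (iwasawaPhi g) = c / Real.sqrt (c ^ 2 + d ^ 2) := by
    rw [hk, Real.sin_sub_int_mul_two_pi, Complex.sin_arg, hnorm]
  have hr : 0 < Real.sqrt (c ^ 2 + d ^ 2) := Real.sqrt_pos.2 hN
  have hr2 : Real.sqrt (c ^ 2 + d ^ 2) ^ 2 = c ^ 2 + d ^ 2 := Real.sq_sqrt hN.le
  rw [hre, him, hcos, hsin, Real.sqrt_div zero_le_one, Real.sqrt_one]
  set r := Real.sqrt (c ^ 2 + d ^ 2)
  rw [← hr2]
  ext i j
  fin_cases i <;> fin_cases j <;> simp [Matrix.mul_apply, Fin.sum_univ_two]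
  · change a = _
    field_simp
    linear_combination a * hr2 + d * hdet
  · change b = _
    field_simp
    linear_combination b * hr2 - c * hdet
  · change c = _
    field_simp
  · change d = _
    field_simp

/-- Every `(g, ξ)` is `(I₂, (λ, μ)) (g, (0, 0))` with `(λ, μ) = ξ g⁻¹`. -/
theorem coord_decomposition {m n : ℕ} (x : JacobiGroup m n ℝ) :
    x = ⟨1, pairMul x.vec x.sl⁻¹⟩ * ⟨x.sl, 0⟩ := by
  apply JacobiGroup.ext <;> simp [mul_def, ← pairMul_mul, pairMul_one]

/-- The theta sum as a function on `G^{(m,n)}`. The point with coordinates `(τ, φ; λ, μ)` is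
the product `(I₂, (λ, μ)) ((τ, φ), (0, 0))`, so that `(g, ξ)` has `(λ, μ) = ξ g⁻¹`. -/
def thetaFun {m n : ℕ} (M : Matrix (Fin m) (Fin m) ℝ) (f : Mat m n ℝ → ℂ)
    (x : JacobiGroup m n ℝ) : ℂ :=
  theta M f (iwasawaTau x.sl) (iwasawaPhi x.sl)
    (pairMul x.vec x.sl⁻¹).1 (pairMul x.vec x.sl⁻¹).2

end

end ThetaSum

/-!
The theta sums are values of the Weil representation summed over a self-dual lattice, and the phase
by which an element of `Γ_{[2]}` multiplies them does not depend on the Schwartz function. The phase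
is unimodular, so it cancels in `Θ_f * conj Θ_g`.

Since `det M = 1`, the space of matrices with the form `(x, y)_M` is isometric to a Euclidean space
`E`, the isometry `L` preserving volume (`exists_isometry`), and the image of the integral matrices
is a self-dual lattice (`exists_dual_equiv`). On Schwartz functions on `E` there are the chirps
`C_t`, multiplication by `exp (π i t ‖x‖²)`, the dilations `D_a` and the Fourier transform `F`.
In these terms the rotation by `φ` is `C_{cot φ} D_{1/sin φ} F C_{cot φ}`, or `D_{±1}` when
`sin φ = 0`, and the theta sum at `(τ, φ; λ, μ)` is the sum over the lattice of
`exp (2 π i ⟪ω, μ⟫) (C_u D_{√v} R(φ) h)(ω + λ)` (`theta_eq`). In particular the summands are values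
of a Schwartz function, which gives absolute convergence.

Under the generator `S` the parameters change by `τ ↦ -1/τ`, `φ ↦ φ + arg τ`. Poisson summation
(`tsum_character_eq`) replaces the operator at `(τ, φ)` by its composition with `F`, so what is
needed is that this composition is the operator at the new parameters, up to a constant of modulus
one (`fourier_weilOp`). By the commutation rules for chirps, dilations and `F` this reduces to the
relation `F C_p F = c C_{-1/p} D_{1/p} F C_{-1/p}` (`fourier_chirp_fourier`), which is the
multiplication formula `∫ ĝ h = ∫ g ĥ` for a Gaussian `g` of complex width `ε - i p` in the limit
`ε → 0`. The case distinction in `fourier_weilOp` is the Bruhat decomposition: one of the two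
rotations may be `± 1`.

The generators `(T_*, (0, s))` and `(1, (λ₀, μ₀))` act by explicit characters, because the form is
integral on integral matrices (`theta_add_two`, `theta_add_castMat`).
-/

namespace ThetaSum

open MeasureTheory Filter Complex
open scoped FourierTransform Real Topology InnerProductSpace

noncomputable section

section operators

/-! ### Functions of temperate growth -/

theorem hasTemperateGrowth_cexp_mul_I : (fun t : ℝ => cexp (t * I)).HasTemperateGrowth := by
  refine ⟨(Complex.ofRealCLM.contDiff.mul contDiff_const).cexp, fun n => ⟨0, 1, fun t => ?_⟩⟩
  have key : ∀ n : ℕ, iteratedDeriv n (fun t : ℝ => cexp (t * I)) =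
      fun t : ℝ => I ^ n * cexp (t * I) := by
    intro n
    induction n with
    | zero => simp
    | succ n ih =>
      rw [iteratedDeriv_succ, ih]
      funext t
      have h : HasDerivAt (fun t : ℝ => cexp (t * I)) (cexp (t * I) * (1 * I)) t :=
        ((Complex.ofRealCLM.hasDerivAt (x := t)).mul_const I).cexp
      rw [(h.const_mul (I ^ n)).deriv]
      ring
  rw [norm_iteratedFDeriv_eq_norm_iteratedDeriv, key]
  simp [Complex.norm_exp_ofReal_mul_I]

theorem hasTemperateGrowth_cexp_ofReal_mul_I {V : Type*} [NormedAddCommGroup V] [NormedSpace ℝ V]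
    {q : V → ℝ} (hq : q.HasTemperateGrowth) :
    (fun x => cexp (q x * I)).HasTemperateGrowth :=
  hasTemperateGrowth_cexp_mul_I.comp hq

variable {E : Type*} [NormedAddCommGroup E] [InnerProductSpace ℝ E]

theorem hasTemperateGrowth_chirp (t : ℝ) :
    (fun x : E => cexp ((π * (t * ‖x‖ ^ 2) : ℝ) * I)).HasTemperateGrowth := by
  apply hasTemperateGrowth_cexp_ofReal_mul_I (q := fun x : E => π * (t * ‖x‖ ^ 2))
  have h := Function.hasTemperateGrowth_norm_sq (H := E)
  exact (Function.HasTemperateGrowth.const π).mul ((Function.HasTemperateGrowth.const t).mul h)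

/-! ### Chirps, dilations and the Fourier transform -/

/-- Multiplication of a Schwartz function by the chirp `exp (π i t ‖x‖²)`. -/
def chirp (t : ℝ) : 𝓢(E, ℂ) →L[ℂ] 𝓢(E, ℂ) :=
  SchwartzMap.smulLeftCLM ℂ fun x : E => cexp ((π * (t * ‖x‖ ^ 2) : ℝ) * I)

theorem chirp_apply (t : ℝ) (h : 𝓢(E, ℂ)) (x : E) :
    chirp t h x = cexp ((π * (t * ‖x‖ ^ 2) : ℝ) * I) * h x := by
  rw [chirp, SchwartzMap.smulLeftCLM_apply_apply (hasTemperateGrowth_chirp t), smul_eq_mul]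

/-- The unitary dilation `h ↦ |a|^(d/2) h(a x)` of Schwartz functions on a `d`-dimensional space;
it is `0` by convention for `a = 0`. -/
def dilate (a : ℝ) : 𝓢(E, ℂ) →L[ℂ] 𝓢(E, ℂ) :=
  if ha : a ≠ 0 then
    ((|a| ^ ((Module.finrank ℝ E : ℝ) / 2) : ℝ) : ℂ) •
      SchwartzMap.compCLMOfContinuousLinearEquiv ℂ
        (ContinuousLinearEquiv.smulLeft (Units.mk0 a ha) : E ≃L[ℝ] E)
  else 0

theorem dilate_apply {a : ℝ} (ha : a ≠ 0) (h : 𝓢(E, ℂ)) (x : E) :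
    dilate a h x = ((|a| ^ ((Module.finrank ℝ E : ℝ) / 2) : ℝ) : ℂ) * h (a • x) := by
  rw [dilate, dif_pos ha]
  rfl

theorem chirp_chirp (s t : ℝ) (h : 𝓢(E, ℂ)) : chirp s (chirp t h) = chirp (s + t) h := by
  ext x
  simp only [chirp_apply, ← mul_assoc, ← Complex.exp_add]
  congr 2
  push_cast
  ring

theorem chirp_zero (h : 𝓢(E, ℂ)) : chirp 0 h = h := by
  ext x
  simp [chirp_apply]

theorem dilate_dilate {a b : ℝ} (ha : a ≠ 0) (hb : b ≠ 0) (h : 𝓢(E, ℂ)) :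
    dilate a (dilate b h) = dilate (a * b) h := by
  ext x
  rw [dilate_apply ha, dilate_apply hb, dilate_apply (mul_ne_zero ha hb), abs_mul,
    Real.mul_rpow (abs_nonneg _) (abs_nonneg _), smul_smul, mul_comm b a]
  push_cast
  ring

theorem dilate_one (h : 𝓢(E, ℂ)) : dilate 1 h = h := by
  ext x
  simp [dilate_apply]

theorem dilate_neg_one_apply (h : 𝓢(E, ℂ)) (x : E) : dilate (-1) h x = h (-x) := by
  simp [dilate_apply]

theorem dilate_chirp {a : ℝ} (ha : a ≠ 0) (t : ℝ) (h : 𝓢(E, ℂ)) :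
    dilate a (chirp t h) = chirp (a ^ 2 * t) (dilate a h) := by
  ext x
  rw [dilate_apply ha, chirp_apply, chirp_apply, dilate_apply ha, norm_smul, Real.norm_eq_abs,
    mul_pow, sq_abs, mul_left_comm]
  congr 4
  ring

/-- The unimodular constant `|p|^(d/2) (i/p)^(d/2)` in the Fourier transform of the chirp
`exp (π i p ‖x‖²)`, an eighth root of unity. -/
def gaussPhase (E : Type*) [NormedAddCommGroup E] [InnerProductSpace ℝ E] (p : ℝ) : ℂ :=
  ((|p| ^ ((Module.finrank ℝ E : ℝ) / 2) : ℝ) : ℂ) * (I / p) ^ (Module.finrank ℝ E / 2 : ℂ)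

theorem norm_gaussPhase {p : ℝ} (hp : p ≠ 0) : ‖gaussPhase E p‖ = 1 := by
  have hz : I / p ≠ 0 := div_ne_zero I_ne_zero (by exact_mod_cast hp)
  have hc : (Module.finrank ℝ E / 2 : ℂ) = ((Module.finrank ℝ E / 2 : ℝ) : ℂ) := by push_cast; rfl
  have h0 : 0 < |p| := abs_pos.2 hp
  rw [gaussPhase, norm_mul, hc, Complex.norm_cpow_of_ne_zero hz]
  simp only [norm_real, ofReal_re, ofReal_im, mul_zero, Real.exp_zero, div_one, norm_div, norm_I,
    Real.norm_eq_abs]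
  rw [abs_of_nonneg (by positivity), ← Real.mul_rpow h0.le (by positivity)]
  rw [mul_one_div_cancel h0.ne', Real.one_rpow]

variable [FiniteDimensional ℝ E] [MeasurableSpace E] [BorelSpace E]

theorem fourier_dilate {a : ℝ} (ha : a ≠ 0) (h : 𝓢(E, ℂ)) :
    𝓕 (dilate a h) = dilate a⁻¹ (𝓕 h) := by
  ext x
  rw [dilate_apply (inv_ne_zero ha), SchwartzMap.fourier_coe, SchwartzMap.fourier_coe,
    Real.fourier_eq', Real.fourier_eq']
  have key := Measure.integral_comp_smul volume
    (fun v => cexp ((-2 * π * ⟪v, a⁻¹ • x⟫_ℝ : ℝ) * I) • h v) a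
  have hin (v : E) : ⟪a • v, a⁻¹ • x⟫_ℝ = ⟪v, x⟫_ℝ := by
    rw [real_inner_smul_left, real_inner_smul_right, mul_inv_cancel_left₀ ha]
  simp only [hin] at key
  simp_rw [dilate_apply ha, smul_eq_mul, mul_left_comm, integral_const_mul]
  simp_rw [smul_eq_mul] at key
  rw [key, real_smul, ← mul_assoc, ← Complex.ofReal_mul]
  congr 2
  have hp : 0 < |a| := abs_pos.2 ha
  rw [abs_inv, abs_inv, abs_pow, Real.inv_rpow hp.le, ← div_eq_mul_inv, ← Real.rpow_natCast,
    ← Real.rpow_sub hp, ← Real.rpow_neg hp.le]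
  congr 1
  ring

theorem fourier_fourier (h : 𝓢(E, ℂ)) : 𝓕 (𝓕 h) = dilate (-1) h := by
  ext x
  rw [dilate_neg_one_apply]
  have := congrArg (fun g : 𝓢(E, ℂ) => g (-x)) 
    (FourierTransform.fourierInv_fourier_eq (F := 𝓢(E, ℂ)) h)
  simp only [SchwartzMap.fourierInv_apply_eq] at this
  rw [← this]
  simp

theorem re_inv_nonneg_of_re_pos {b : ℂ} (hb : 0 < b.re) : 0 ≤ (b⁻¹).re := by
  rw [Complex.inv_re]
  exact div_nonneg hb.le (normSq_nonneg _)

/-- The regularized form of `fourier_chirp_fourier`: the multiplication formula for the Fourier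
transform applied to a Gaussian with complex width `b`. -/
theorem integral_gaussian_mul_fourier {b : ℂ} (hb : 0 < b.re) (h : 𝓢(E, ℂ)) (x : E) :
    ∫ v, cexp (-(π * b) * ‖v‖ ^ 2 + 2 * π * I * ⟪-x, v⟫_ℝ) * 𝓕 h v =
      (b⁻¹) ^ (Module.finrank ℝ E / 2 : ℂ) * ∫ w, cexp (-π * ‖x + w‖ ^ 2 * b⁻¹) * h w := by
  have hb' : 0 < ((π : ℂ) * b).re := by
    rw [Complex.re_ofReal_mul]
    exact mul_pos Real.pi_pos hb
  have hint : Integrable (fun v : E => cexp (-(π * b) * ‖v‖ ^ 2 + 2 * π * I * ⟪-x, v⟫_ℝ)) :=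
    GaussianFourier.integrable_cexp_neg_mul_sq_norm_add hb' _ _
  have key := VectorFourier.integral_fourierIntegral_smul_eq_flip (L := innerₗ E)
    (μ := volume) (ν := volume) (e := 𝐞) Real.continuous_fourierChar continuous_inner hint
    h.integrable
  rw [flip_innerₗ] at key
  have hb0 : b ≠ 0 := fun h0 => by simp [h0] at hb
  have hpi : (π : ℂ) ≠ 0 := by exact_mod_cast Real.pi_ne_zero
  calc _ = ∫ w, 𝓕 (fun v : E => cexp (-(π * b) * ‖v‖ ^ 2 + 2 * π * I * ⟪-x, v⟫_ℝ)) w * h w :=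
        key.symm
    _ = _ := by
      simp_rw [fourier_gaussian_innerProductSpace' hb', mul_assoc]
      rw [integral_const_mul]
      congr 2
      · field_simp
      · funext w
        have h1 : ‖-x - w‖ = ‖x + w‖ := by rw [← norm_neg]; congr 1; abel
        rw [h1]
        congr 2
        field_simp

/-- The Fourier transform of a chirp with `p ≠ 0`, tested against `h`. The chirp is not integrable,
so the identity is obtained as the limit of `integral_gaussian_mul_fourier` at width `ε - i p`; both
sides converge by dominated convergence because `h` and `𝓕 h` are integrable. -/
theorem integral_chirp_mul_fourier {p : ℝ} (hp : p ≠ 0) (h : 𝓢(E, ℂ)) (x : E) :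
    ∫ v, cexp (π * I * (p * ‖v‖ ^ 2 - 2 * ⟪v, x⟫_ℝ)) * 𝓕 h v =
      (I / p) ^ (Module.finrank ℝ E / 2 : ℂ) *
        ∫ w, cexp (-(π * I * ‖x + w‖ ^ 2 / p)) * h w := by
  -- the width `b = ε - i p` tends to `- i p` as `ε` decreases to zero
  have hpc : (p : ℂ) ≠ 0 := by exact_mod_cast hp
  have hbt : Tendsto (fun ε : ℝ => (ε : ℂ) - I * p) (𝓝[>] 0) (𝓝 (-(I * p))) := by
    have : Continuous (fun ε : ℝ => (ε : ℂ) - I * p) := by fun_prop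
    have h1 := this.tendsto 0
    simp only [ofReal_zero, zero_sub] at h1
    exact h1.mono_left nhdsWithin_le_nhds
  have hne : -(I * p) ≠ 0 := neg_ne_zero.2 (mul_ne_zero I_ne_zero hpc)
  have hinv : (-(I * (p : ℂ)))⁻¹ = I / p := by
    rw [inv_neg, mul_inv, inv_I, neg_mul, neg_neg, div_eq_mul_inv]
  have hbi : Tendsto (fun ε : ℝ => ((ε : ℂ) - I * p)⁻¹) (𝓝[>] 0) (𝓝 (I / p)) := by
    rw [← hinv]
    exact hbt.inv₀ hne
  have hre : ∀ᶠ ε : ℝ in 𝓝[>] 0, 0 < ((ε : ℂ) - I * p).re := by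
    filter_upwards [self_mem_nhdsWithin] with ε hε
    simpa using hε
  -- the branch of the power is continuous at `i / p`, which is not on the negative real axis
  have hslit : I / p ∈ slitPlane := by
    right
    have : (I / (p : ℂ)).im = p⁻¹ := by
      rw [div_eq_mul_inv, ← Complex.ofReal_inv]
      simp
    rw [this]
    exact inv_ne_zero hp
  have hL : Tendsto (fun ε : ℝ => ∫ v, cexp (-(π * ((ε : ℂ) - I * p)) * ‖v‖ ^ 2
      + 2 * π * I * ⟪-x, v⟫_ℝ) * 𝓕 h v) (𝓝[>] 0)
      (𝓝 (∫ v, cexp (π * I * (p * ‖v‖ ^ 2 - 2 * ⟪v, x⟫_ℝ)) * 𝓕 h v)) := by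
    refine tendsto_integral_filter_of_dominated_convergence (fun v => ‖𝓕 h v‖)
      (Eventually.of_forall fun ε => ?_) ?_ (𝓕 h).integrable.norm (Eventually.of_forall fun v => ?_)
    · refine Continuous.aestronglyMeasurable ?_
      have := (𝓕 h).continuous
      fun_prop
    · filter_upwards [hre] with ε hε
      refine Eventually.of_forall fun v => ?_
      rw [norm_mul]
      refine mul_le_of_le_one_left (norm_nonneg _) ?_
      rw [Complex.norm_exp, Real.exp_le_one_iff]
      have : (-(π * ((ε : ℂ) - I * p)) * ‖v‖ ^ 2 + 2 * π * I * ⟪-x, v⟫_ℝ).re =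
          -(π * ε * ‖v‖ ^ 2) := by
        simp [← ofReal_pow]
      rw [this]
      have hε' : 0 < ε := by simpa using hε
      have := Real.pi_pos
      exact neg_nonpos.2 (by positivity)
    · refine Tendsto.mul_const _ ?_
      have h1 := ((((hbt.const_mul (π : ℂ)).neg).mul_const ((‖v‖ : ℂ) ^ 2)).add_const
        (2 * π * I * ⟪-x, v⟫_ℝ : ℂ)).cexp
      convert h1 using 2
      rw [inner_neg_left, real_inner_comm]
      push_cast
      ring_nf
  have hR : Tendsto (fun ε : ℝ => (((ε : ℂ) - I * p)⁻¹) ^ (Module.finrank ℝ E / 2 : ℂ) *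
      ∫ w, cexp (-π * ‖x + w‖ ^ 2 * ((ε : ℂ) - I * p)⁻¹) * h w) (𝓝[>] 0)
      (𝓝 ((I / p) ^ (Module.finrank ℝ E / 2 : ℂ) *
        ∫ w, cexp (-(π * I * ‖x + w‖ ^ 2 / p)) * h w)) := by
    refine (hbi.cpow tendsto_const_nhds hslit).mul ?_
    refine tendsto_integral_filter_of_dominated_convergence (fun v => ‖h v‖)
      (Eventually.of_forall fun ε => ?_) ?_ h.integrable.norm (Eventually.of_forall fun w => ?_)
    · refine Continuous.aestronglyMeasurable ?_
      have := h.continuous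
      fun_prop
    · filter_upwards [hre] with ε hε
      refine Eventually.of_forall fun w => ?_
      rw [norm_mul]
      refine mul_le_of_le_one_left (norm_nonneg _) ?_
      rw [Complex.norm_exp, Real.exp_le_one_iff]
      have : (-π * ‖x + w‖ ^ 2 * ((ε : ℂ) - I * p)⁻¹).re =
          -(π * ‖x + w‖ ^ 2) * (((ε : ℂ) - I * p)⁻¹).re := by
        rw [← Complex.re_ofReal_mul]
        push_cast
        ring_nf
      rw [this]
      have := re_inv_nonneg_of_re_pos hε
      have := Real.pi_pos
      exact mul_nonpos_of_nonpos_of_nonneg (neg_nonpos.2 (by positivity)) ‹_›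
    · refine Tendsto.mul_const _ ?_
      have h1 := (hbi.const_mul (-π * (‖x + w‖ : ℂ) ^ 2)).cexp
      convert h1 using 2
      ring_nf
  refine tendsto_nhds_unique_of_eventuallyEq hL hR ?_
  filter_upwards [hre] with ε hε
  exact integral_gaussian_mul_fourier hε h x

/-- The relation `F C_p F = c C_{-1/p} D_{1/p} F C_{-1/p}` between the Fourier transform, chirps
and dilations. It lifts the factorization of `S (1 p; 0 1) S` through the big Bruhat cell of
`SL(2,ℝ)`. -/
theorem fourier_chirp_fourier {p : ℝ} (hp : p ≠ 0) (h : 𝓢(E, ℂ)) :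
    𝓕 (chirp p (𝓕 h)) =
      gaussPhase E p • chirp (-p⁻¹) (dilate p⁻¹ (𝓕 (chirp (-p⁻¹) h))) := by
  ext x
  have hpc : (p : ℂ) ≠ 0 := by exact_mod_cast hp
  have hp0 : 0 < |p| := abs_pos.2 hp
  rw [smul_apply, chirp_apply, dilate_apply (inv_ne_zero hp), SchwartzMap.fourier_coe,
    SchwartzMap.fourier_coe, Real.fourier_eq', Real.fourier_eq', smul_eq_mul, gaussPhase]
  have h1 : ((|p| ^ ((Module.finrank ℝ E : ℝ) / 2) : ℝ) : ℂ) *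
      ((|p⁻¹| ^ ((Module.finrank ℝ E : ℝ) / 2) : ℝ) : ℂ) = 1 := by
    rw [← ofReal_mul, abs_inv, ← Real.mul_rpow hp0.le (by positivity), mul_inv_cancel₀ hp0.ne',
      Real.one_rpow, ofReal_one]
  calc _ = ∫ v, cexp (π * I * (p * ‖v‖ ^ 2 - 2 * ⟪v, x⟫_ℝ)) * 𝓕 h v := by
        congr 1
        funext v
        rw [chirp_apply, smul_eq_mul, ← mul_assoc, ← Complex.exp_add]
        congr 2
        push_cast
        ring
    _ = (I / p) ^ (Module.finrank ℝ E / 2 : ℂ) *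
        (cexp ((π * (-p⁻¹ * ‖x‖ ^ 2) : ℝ) * I) * ∫ v,
          cexp ((-2 * π * ⟪v, p⁻¹ • x⟫_ℝ : ℝ) * I) • chirp (-p⁻¹) h v) := by
        rw [integral_chirp_mul_fourier hp, ← integral_const_mul (cexp _)]
        congr 2
        funext v
        rw [chirp_apply, smul_eq_mul, ← mul_assoc, ← mul_assoc, ← Complex.exp_add,
          ← Complex.exp_add]
        congr 2
        have h2 : (‖x + v‖ : ℂ) ^ 2 = ‖x‖ ^ 2 + 2 * ⟪v, x⟫_ℝ + ‖v‖ ^ 2 := by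
          have := norm_add_sq_real x v
          rw [real_inner_comm] at this
          exact_mod_cast this
        rw [h2, real_inner_smul_right]
        push_cast
        field_simp
        ring
    _ = _ := by
        linear_combination (-(I / (p : ℂ)) ^ (Module.finrank ℝ E / 2 : ℂ) *
        (cexp ((π * (-p⁻¹ * ‖x‖ ^ 2) : ℝ) * I) * ∫ v,
          cexp ((-2 * π * ⟪v, p⁻¹ • x⟫_ℝ : ℝ) * I) • chirp (-p⁻¹) h v)) * h1

end operators

section weil

variable {E : Type*} [NormedAddCommGroup E] [InnerProductSpace ℝ E]

/-! ### The Weil representation in Iwasawa coordinates -/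

theorem chirp_dilate {a : ℝ} (ha : a ≠ 0) (t : ℝ) (h : 𝓢(E, ℂ)) :
    chirp t (dilate a h) = dilate a (chirp (t / a ^ 2) h) := by
  rw [dilate_chirp ha, mul_div_cancel₀ t (pow_ne_zero 2 ha)]

variable [FiniteDimensional ℝ E] [MeasurableSpace E] [BorelSpace E]

/-- The operator attached to the rotation by `φ`, factored through chirps, a dilation and the
Fourier transform when `sin φ ≠ 0`. For `sin φ = 0` it is `h ↦ h (cos φ · x)`, as `cos φ = ± 1`. -/
def rot (φ : ℝ) (h : 𝓢(E, ℂ)) : 𝓢(E, ℂ) :=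
  if Real.sin φ = 0 then dilate (Real.cos φ) h
  else chirp (Real.cos φ / Real.sin φ)
    (dilate (Real.sin φ)⁻¹ (𝓕 (chirp (Real.cos φ / Real.sin φ) h)))

/-- The operator attached to the element of `SL(2,ℝ)` with Iwasawa coordinates
`(u + i v, φ)`. -/
def weilOp (u v φ : ℝ) (h : 𝓢(E, ℂ)) : 𝓢(E, ℂ) :=
  chirp u (dilate (√v) (rot φ h))

/-- Normal form of `weilOp` for rotations by `± 1`. -/
theorem weilOp_of_sin_eq_zero (u : ℝ) {v φ : ℝ} (hv : 0 < v) (hs : Real.sin φ = 0)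
    (h : 𝓢(E, ℂ)) :
    weilOp u v φ h = dilate (√v * Real.cos φ) (chirp (u / v) h) := by
  have hc : Real.cos φ ^ 2 = 1 := by rw [Real.cos_sq', hs]; simp
  have hc0 : Real.cos φ ≠ 0 := fun h0 => by simp [h0] at hc
  have hq := (Real.sqrt_pos.2 hv).ne'
  rw [weilOp, rot, if_pos hs, dilate_dilate hq hc0, chirp_dilate (mul_ne_zero hq hc0), mul_pow,
    hc, Real.sq_sqrt hv.le, mul_one]

/-- Normal form `C D F C` of `weilOp` on the big Bruhat cell. -/
theorem weilOp_of_sin_ne_zero (u : ℝ) {v φ : ℝ} (hv : 0 < v) (hs : Real.sin φ ≠ 0)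
    (h : 𝓢(E, ℂ)) :
    weilOp u v φ h = chirp (u + v * (Real.cos φ / Real.sin φ))
      (dilate (√v / Real.sin φ) (𝓕 (chirp (Real.cos φ / Real.sin φ) h))) := by
  have hq := (Real.sqrt_pos.2 hv).ne'
  rw [weilOp, rot, if_neg hs, dilate_chirp hq, dilate_dilate hq (inv_ne_zero hs), chirp_chirp,
    Real.sq_sqrt hv.le, div_eq_mul_inv (√v)]

/-- The Fourier transform represents `S`: it maps the operator at `(τ, φ)` to the operator at
`(-1/τ, φ + arg τ)`, up to a unimodular constant which does not depend on the function. -/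
theorem fourier_weilOp {u v φ φ' : ℝ} (hv : 0 < v)
    (hs' : Real.sin φ' = (u * Real.sin φ + v * Real.cos φ) / √(u ^ 2 + v ^ 2))
    (hc' : Real.cos φ' = (u * Real.cos φ - v * Real.sin φ) / √(u ^ 2 + v ^ 2)) :
    ∃ κ : ℂ, ‖κ‖ = 1 ∧ ∀ h : 𝓢(E, ℂ),
      𝓕 (weilOp u v φ h) = κ • weilOp (-u / (u ^ 2 + v ^ 2)) (v / (u ^ 2 + v ^ 2)) φ' h := by
  have hN : 0 < u ^ 2 + v ^ 2 := by positivity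
  have hv' : 0 < v / (u ^ 2 + v ^ 2) := div_pos hv hN
  have hq' : √(v / (u ^ 2 + v ^ 2)) = √v / √(u ^ 2 + v ^ 2) := Real.sqrt_div hv.le _
  have hq : 0 < √v := Real.sqrt_pos.2 hv
  have hr : 0 < √(u ^ 2 + v ^ 2) := Real.sqrt_pos.2 hN
  have hq2 : √v ^ 2 = v := Real.sq_sqrt hv.le
  have hr2 : √(u ^ 2 + v ^ 2) ^ 2 = u ^ 2 + v ^ 2 := Real.sq_sqrt hN.le
  have hsc := Real.sin_sq_add_cos_sq φ
  generalize hcdef : Real.cos φ = c at *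
  generalize hsdef : Real.sin φ = s at *
  generalize hqdef : √v = q at *
  generalize hrdef : √(u ^ 2 + v ^ 2) = r at *
  have hv0 := hv.ne'
  have hN0 := hN.ne'
  have hq0 := hq.ne'
  have hr0 := hr.ne'
  by_cases hs : s = 0
  · -- `sin φ = 0`: the Bruhat cell changes from small to big
    subst hs
    have hc2 : c ^ 2 = 1 := by linarith [hsc]
    have hc0 : c ≠ 0 := fun h0 => by simp [h0] at hc2
    have hs0 : Real.sin φ' ≠ 0 := by
      rw [hs', mul_zero, zero_add]
      positivity
    refine ⟨1, norm_one, fun h => ?_⟩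
    rw [weilOp_of_sin_eq_zero u hv hsdef, hcdef, hqdef, fourier_dilate (mul_ne_zero hq0 hc0),
      weilOp_of_sin_ne_zero _ hv' hs0, one_smul, hq', hs', hc']
    have e1 : (u * c - v * 0) / r / ((u * 0 + v * c) / r) = u / v := by
      field_simp
      ring
    have e2 : -u / (u ^ 2 + v ^ 2) + v / (u ^ 2 + v ^ 2) * (u / v) = 0 := by
      field_simp
      ring
    have e3 : q / r / ((u * 0 + v * c) / r) = (q * c)⁻¹ := by
      rw [← hq2]
      field_simp
      ring
    rw [e1, e2, e3, chirp_zero]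
  have hs0 : Real.sin φ ≠ 0 := by rwa [hsdef]
  have hup : u * s + v * c = (u + v * (c / s)) * s := by
    field_simp
  by_cases hp : u + v * (c / s) = 0
  · -- `sin φ' = 0`: the Bruhat cell changes from big to small
    have hs1 : Real.sin φ' = 0 := by rw [hs', hup, hp, zero_mul, zero_div]
    have hu : u = -(v * (c / s)) := by linarith
    have hr3 : r ^ 2 * s ^ 2 = v ^ 2 := by
      rw [hr2, hu]
      field_simp
      linear_combination hsc
    refine ⟨1, norm_one, fun h => ?_⟩
    have hc3 : (u * c - v * s) / r = -(r * s / v) := by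
      rw [hu]
      field_simp
      linear_combination hr3 - v ^ 2 * hsc
    rw [weilOp_of_sin_ne_zero u hv hs0, hcdef, hsdef, hqdef, hp, chirp_zero,
      fourier_dilate (div_ne_zero hq0 hs), fourier_fourier,
      dilate_dilate (inv_ne_zero (div_ne_zero hq0 hs)) (by norm_num),
      weilOp_of_sin_eq_zero _ hv' hs1, one_smul, hq', hc', hc3]
    have e1 : -u / (u ^ 2 + v ^ 2) / (v / (u ^ 2 + v ^ 2)) = c / s := by
      rw [div_div_div_cancel_right₀ hN0, hu, neg_neg, mul_div_cancel_left₀ _ hv0]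
    have e2 : q / r * -(r * s / v) = (q / s)⁻¹ * -1 := by
      rw [← hq2]
      field_simp
    rw [e1, e2]
  · -- the generic case, in which both rotations lie in the big Bruhat cell
    have hs1 : Real.sin φ' ≠ 0 := by
      rw [hs', hup]
      exact div_ne_zero (mul_ne_zero hp hs) hr0
    refine ⟨gaussPhase E (u + v * (c / s)), norm_gaussPhase hp, fun h => ?_⟩
    have hqs : q / s ≠ 0 := div_ne_zero hq0 hs
    have ha := inv_ne_zero hqs
    have hpi := inv_ne_zero hp
    rw [weilOp_of_sin_ne_zero u hv hs0, hcdef, hsdef, hqdef]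
    -- the inner dilation has to be moved inside `F` before the relation for `F C_p F` applies
    have hd : dilate (q / s) (𝓕 (chirp (c / s) h)) = 𝓕 (dilate (q / s)⁻¹ (chirp (c / s) h)) := by
      rw [fourier_dilate ha, inv_inv]
    rw [hd, fourier_chirp_fourier hp, chirp_dilate ha, chirp_chirp, fourier_dilate ha, inv_inv,
      dilate_dilate hpi hqs, weilOp_of_sin_ne_zero _ hv' hs1, hq', hs', hc', hup]
    generalize hpdef : u + v * (c / s) = p at *
    have hu : u = p - v * (c / s) := by linarith
    have e1 : (u * c - v * s) / r / (p * s / r) = -p⁻¹ / (q / s)⁻¹ ^ 2 + c / s := by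
      rw [div_div_div_cancel_right₀ hr0, inv_pow, div_inv_eq_mul, div_pow, hq2, hu]
      field_simp
      linear_combination (-v) * hsc
    have e2 : -u / (u ^ 2 + v ^ 2) + v / (u ^ 2 + v ^ 2) *
        (-p⁻¹ / (q / s)⁻¹ ^ 2 + c / s) = -p⁻¹ := by
      rw [← e1, div_div_div_cancel_right₀ hr0]
      field_simp
      rw [hu]
      field_simp
      ring
    have e3 : q / r / (p * s / r) = p⁻¹ * (q / s) := by
      field_simp
    rw [e1, e2, e3]

end weil

/-! ### Poisson summation in several variables -/

/-- The integer vector `n` regarded as a real vector. -/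
def intVec {ι : Type*} (n : ι → ℤ) : ι → ℝ := fun i => n i

section poisson

variable {ι : Type*} [Fintype ι]

/-- Some negative power of `1 + ‖n‖` is summable over the integer lattice. -/
theorem summable_one_add_norm_intVec :
    ∃ N : ℕ, Summable fun n : ι → ℤ => ((1 + ‖intVec n‖) ^ N)⁻¹ := by
  let Λ : Submodule ℤ (ι → ℝ) := Submodule.span ℤ (Set.range (Pi.basisFun ℝ ι))
  have hmem (n : ι → ℤ) : intVec n ∈ Λ := by
    rw [Module.Basis.mem_span_iff_repr_mem ℤ]
    exact fun i => ⟨n i, by simp [intVec]⟩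
  have hinj : Function.Injective fun n : ι → ℤ => (⟨intVec n, hmem n⟩ : Λ) := by
    intro n k h
    funext i
    have h1 : intVec n i = intVec k i := congrFun (congrArg Subtype.val h) i
    exact Int.cast_injective h1
  refine ⟨Module.finrank ℤ Λ + 1, ?_⟩
  have hs := (ZLattice.summable_norm_pow_inv Λ _ (Nat.lt_succ_self _)).comp_injective hinj
  -- the comparison with `‖n‖⁻¹ ^ N` fails only at the origin, where `0⁻¹ = 0`
  refine Summable.of_norm_bounded_eventually hs ?_
  refine (Set.finite_singleton (0 : ι → ℤ)).subset fun n hn => ?_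
  by_contra h0
  refine hn ?_
  have hpos : 0 < ‖intVec n‖ := by
    rw [norm_pos_iff]
    intro h
    apply h0
    funext i
    have := congrFun h i
    simpa [intVec] using this
  simp only [Set.mem_ofPred_eq, Function.comp_apply, Submodule.coe_norm, ← inv_pow]
  rw [Real.norm_of_nonneg (by positivity)]
  gcongr
  linarith

/-- Integer translates of a Schwartz function are dominated, uniformly on bounded sets, by a
summable family. -/
theorem exists_summable_bound (G : 𝓢(ι → ℝ, ℂ)) (R : ℝ) :
    ∃ b : (ι → ℤ) → ℝ, Summable b ∧
      ∀ n x, ‖x‖ ≤ R → ‖G (x + intVec n)‖ ≤ b n := by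
  obtain ⟨N, hN⟩ := summable_one_add_norm_intVec (ι := ι)
  have hdec := SchwartzMap.one_add_le_sup_seminorm_apply (𝕜 := ℝ) (m := (N, 0)) (k := N) (n := 0)
    le_rfl le_rfl G
  simp only [norm_iteratedFDeriv_zero] at hdec
  set C := 2 ^ N * ((Finset.Iic (N, 0)).sup fun m => SchwartzMap.seminorm ℝ m.1 m.2) G
  refine ⟨fun n => C * (1 + R) ^ N * ((1 + ‖intVec n‖) ^ N)⁻¹, hN.mul_left _, fun n x hx => ?_⟩
  have hR : 0 ≤ R := (norm_nonneg x).trans hx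
  have h1 : 1 + ‖intVec n‖ ≤ (1 + ‖x + intVec n‖) * (1 + R) := by
    have h2 : ‖intVec n‖ ≤ ‖x + intVec n‖ + ‖x‖ := by
      have := norm_sub_le (x + intVec n) x
      rwa [add_sub_cancel_left] at this
    nlinarith [norm_nonneg (x + intVec n)]
  beta_reduce
  rw [← div_eq_mul_inv, le_div_iff₀ (by positivity)]
  calc ‖G (x + intVec n)‖ * (1 + ‖intVec n‖) ^ N
      ≤ ‖G (x + intVec n)‖ * ((1 + ‖x + intVec n‖) * (1 + R)) ^ N := by gcongr
    _ = ((1 + ‖x + intVec n‖) ^ N * ‖G (x + intVec n)‖) * (1 + R) ^ N := by rw [mul_pow]; ring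
    _ ≤ C * (1 + R) ^ N := by gcongr; exact hdec _

theorem summable_intVec (G : 𝓢(ι → ℝ, ℂ)) : Summable fun n : ι → ℤ => G (intVec n) := by
  obtain ⟨b, hb, h⟩ := exists_summable_bound G 0
  refine Summable.of_norm_bounded hb fun n => ?_
  simpa using h n 0 (by simp)

/-- The periodization `x ↦ ∑ G (x + n)` of a Schwartz function over the integer lattice. -/
def periodization (G : 𝓢(ι → ℝ, ℂ)) (x : ι → ℝ) : ℂ := ∑' n : ι → ℤ, G (x + intVec n)

theorem continuous_periodization (G : 𝓢(ι → ℝ, ℂ)) : Continuous (periodization G) := by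
  rw [continuous_iff_continuousAt]
  intro x
  obtain ⟨b, hb, h⟩ := exists_summable_bound G (‖x‖ + 1)
  have hc : ContinuousOn (periodization G) (Metric.ball 0 (‖x‖ + 1)) := by
    refine continuousOn_tsum (fun n => ?_) hb fun n y hy => h n y ?_
    · have := G.continuous
      exact Continuous.continuousOn (by fun_prop)
    · exact (mem_ball_zero_iff.1 hy).le
  exact hc.continuousAt (Metric.isOpen_ball.mem_nhds (by simp))

theorem periodization_add_intVec (G : 𝓢(ι → ℝ, ℂ)) (x : ι → ℝ) (k : ι → ℤ) :
    periodization G (x + intVec k) = periodization G x := by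
  rw [periodization, periodization,
    ← (Equiv.addLeft k).tsum_eq fun n => G (x + intVec n)]
  refine tsum_congr fun n => ?_
  congr 1
  ext i
  simp [intVec, add_assoc]

/-- The projection from `ℝ^ι` to the torus. -/
def torusMk (x : ι → ℝ) : UnitAddTorus ι := fun i => (x i : UnitAddCircle)

omit [Fintype ι] in
theorem isOpenQuotientMap_torusMk : IsOpenQuotientMap (torusMk (ι := ι)) :=
  IsOpenQuotientMap.piMap fun _ => QuotientAddGroup.isOpenQuotientMap_mk

omit [Fintype ι] in
theorem torusMk_eq_iff {x y : ι → ℝ} (h : torusMk x = torusMk y) :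
    ∃ k : ι → ℤ, y = x + intVec k := by
  have h1 (i : ι) : ∃ k : ℤ, y i = x i + k := by
    have h2 : ((x i : UnitAddCircle)) = y i := congrFun h i
    have h3 : ((y i - x i : ℝ) : UnitAddCircle) = 0 := by rw [AddCircle.coe_sub, h2, sub_self]
    obtain ⟨k, hk⟩ := (AddCircle.coe_eq_zero_iff (1 : ℝ)).1 h3
    exact ⟨k, by rw [zsmul_one] at hk; linarith⟩
  choose k hk using h1
  exact ⟨k, funext hk⟩

/-- The periodization as a function on the torus, evaluated through a choice of representatives. -/
def torusPeriodization (G : 𝓢(ι → ℝ, ℂ)) (t : UnitAddTorus ι) : ℂ :=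
  periodization G (Function.surjInv isOpenQuotientMap_torusMk.surjective t)

theorem torusPeriodization_torusMk (G : 𝓢(ι → ℝ, ℂ)) (x : ι → ℝ) :
    torusPeriodization G (torusMk x) = periodization G x := by
  obtain ⟨k, hk⟩ := torusMk_eq_iff
    (Function.surjInv_eq isOpenQuotientMap_torusMk.surjective (torusMk x))
  conv_rhs => rw [hk, periodization_add_intVec]
  rfl

theorem continuous_torusPeriodization (G : 𝓢(ι → ℝ, ℂ)) : Continuous (torusPeriodization G) := by
  rw [isOpenQuotientMap_torusMk.isQuotientMap.continuous_iff]
  exact (continuous_periodization G).congr fun x => (torusPeriodization_torusMk G x).symm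

theorem mFourier_torusMk (k : ι → ℤ) (x : ι → ℝ) :
    UnitAddTorus.mFourier k (torusMk x) = cexp ((2 * π * ∑ i, k i * x i : ℝ) * I) := by
  simp only [UnitAddTorus.mFourier, torusMk, ContinuousMap.coe_mk, fourier_coe_apply]
  rw [← Complex.exp_sum]
  congr 1
  push_cast
  rw [Finset.mul_sum, Finset.sum_mul]
  refine Finset.sum_congr rfl fun i _ => ?_
  simp
  ring

omit [Fintype ι] in
theorem iUnion_translates_unit_cube :
    ⋃ n : ι → ℤ, {x : ι → ℝ | ∀ i, x i - n i ∈ Set.Ioc (0 : ℝ) 1} = Set.univ := by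
  refine Set.eq_univ_of_forall fun x => Set.mem_iUnion.2 ⟨fun i => ⌈x i⌉ - 1, fun i => ?_⟩
  have h1 := Int.ceil_lt_add_one (x i)
  have h2 := Int.le_ceil (x i)
  push_cast
  constructor <;> linarith

omit [Fintype ι] in
theorem pairwise_disjoint_translates_unit_cube :
    Pairwise (Function.onFun Disjoint
      fun n : ι → ℤ => {x : ι → ℝ | ∀ i, x i - n i ∈ Set.Ioc (0 : ℝ) 1}) := by
  intro n k hnk
  refine Set.disjoint_left.2 fun x hx hx' => hnk (funext fun i => ?_)
  obtain ⟨h1, h2⟩ := hx i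
  obtain ⟨h3, h4⟩ := hx' i
  have h5 : (n i : ℝ) < k i + 1 := by linarith
  have h6 : (k i : ℝ) < n i + 1 := by linarith
  norm_cast at h5 h6
  omega

/-- An integral over `ℝ^ι` is the sum of the integrals over the unit cube of all integer
translates. -/
theorem hasSum_integral_translates {F : Type*} [NormedAddCommGroup F] [NormedSpace ℝ F]
    {f : (ι → ℝ) → F} (hf : Integrable f) :
    HasSum (fun n : ι → ℤ => ∫ x in {x : ι → ℝ | ∀ i, x i ∈ Set.Ioc (0 : ℝ) 1}, f (x + intVec n))
      (∫ x, f x) := by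
  have hmeas (n : ι → ℤ) : MeasurableSet {x : ι → ℝ | ∀ i, x i - n i ∈ Set.Ioc (0 : ℝ) 1} :=
    MeasurableSet.univ_pi' (t := fun i => {y : ℝ | y - n i ∈ Set.Ioc (0 : ℝ) 1}) fun i =>
      (measurable_id.sub_const (n i : ℝ)) measurableSet_Ioc
  have key := hasSum_integral_iUnion (μ := volume) (f := f) hmeas
    pairwise_disjoint_translates_unit_cube hf.integrableOn
  rw [iUnion_translates_unit_cube, Measure.restrict_univ] at key
  convert key using 2 with n
  have h := (measurePreserving_add_right (volume : Measure (ι → ℝ))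
    (intVec n)).setIntegral_preimage_emb (measurableEmbedding_addRight (intVec n)) f {x : ι → ℝ | ∀ i, x i - n i ∈ Set.Ioc (0 : ℝ) 1}
  rw [← h]
  congr 2
  ext x
  simp [intVec]

/-- The Fourier coefficients of the periodization are values of the Fourier transform. -/
theorem mFourierCoeff_torusPeriodization (G : 𝓢(ι → ℝ, ℂ)) (k : ι → ℤ) :
    UnitAddTorus.mFourierCoeff (torusPeriodization G) k =
      ∫ x : ι → ℝ, cexp (-(2 * π * ∑ i, k i * x i : ℝ) * I) * G x := by
  set e : (ι → ℝ) → ℂ := fun x => cexp (-(2 * π * ∑ i, k i * x i : ℝ) * I) with he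
  have he1 (x : ι → ℝ) : ‖e x‖ = 1 := by
    rw [he]
    simp only [← ofReal_neg]
    exact Complex.norm_exp_ofReal_mul_I _
  have hcont : Continuous e := by
    rw [he]
    fun_prop
  have hper (x : ι → ℝ) (n : ι → ℤ) : e (x + intVec n) = e x := by
    rw [he]
    simp only
    have h0 : (2 * π * ∑ i, k i * (x + intVec n) i : ℝ) =
        (2 * π * ∑ i, k i * x i : ℝ) + (∑ i, k i * n i : ℤ) * (2 * π) := by
      simp only [Pi.add_apply, mul_add, Finset.sum_add_distrib, intVec]
      push_cast
      ring
    rw [h0]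
    have := Complex.exp_periodic.int_mul (-(∑ i, k i * n i)) (-(2 * π * ∑ i, k i * x i : ℝ) * I)
    rw [← this]
    congr 1
    push_cast
    ring
  have hmF (x : ι → ℝ) : UnitAddTorus.mFourier (-k) (torusMk x) = e x := by
    rw [mFourier_torusMk, he]
    simp only [Pi.neg_apply]
    congr 1
    push_cast
    simp
  have hint : Integrable fun x => e x * G x := by
    have := G.integrable (μ := volume)
    exact this.bdd_mul hcont.aestronglyMeasurable (ae_of_all _ fun x => (he1 x).le)
  rw [UnitAddTorus.mFourierCoeff_eq_integral _ _ 0]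
  have hset : {x : ι → ℝ | ∀ i, x i ∈ Set.Ioc ((0 : ι → ℝ) i) ((0 : ι → ℝ) i + 1)} =
      {x : ι → ℝ | ∀ i, x i ∈ Set.Ioc (0 : ℝ) 1} := by simp
  rw [hset]
  have hfun (x : ι → ℝ) : UnitAddTorus.mFourier (-k) (fun i => (x i : UnitAddCircle)) •
      torusPeriodization G (fun i => (x i : UnitAddCircle)) =
      ∑' n : ι → ℤ, e (x + intVec n) * G (x + intVec n) := by
    change UnitAddTorus.mFourier (-k) (torusMk x) • torusPeriodization G (torusMk x) = _
    rw [hmF, torusPeriodization_torusMk, periodization, smul_eq_mul, ← tsum_mul_left]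
    simp_rw [hper]
  simp_rw [hfun]
  rw [← (hasSum_integral_translates hint).tsum_eq]
  refine (integral_tsum_of_summable_integral_norm (fun n => ?_) ?_).symm
  · exact (hint.comp_add_right (intVec n)).integrableOn
  · exact (hasSum_integral_translates hint.norm).summable

/-- **Poisson summation** for Schwartz functions on `ℝ^ι`. -/
theorem tsum_intVec_eq_tsum_integral (G : 𝓢(ι → ℝ, ℂ))
    (hs : Summable fun k : ι → ℤ => ∫ x : ι → ℝ, cexp (-(2 * π * ∑ i, k i * x i : ℝ) * I) * G x) :
    ∑' n : ι → ℤ, G (intVec n) =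
      ∑' k : ι → ℤ, ∫ x : ι → ℝ, cexp (-(2 * π * ∑ i, k i * x i : ℝ) * I) * G x := by
  let F : C(UnitAddTorus ι, ℂ) := ⟨torusPeriodization G, continuous_torusPeriodization G⟩
  have hF : Summable (UnitAddTorus.mFourierCoeff F) := by
    refine hs.congr fun k => ?_
    exact (mFourierCoeff_torusPeriodization G k).symm
  have key := (UnitAddTorus.hasSum_mFourier_series_apply_of_summable hF (torusMk 0)).tsum_eq
  have h0 : F (torusMk 0) = ∑' n : ι → ℤ, G (intVec n) := by
    change torusPeriodization G (torusMk 0) = _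
    rw [torusPeriodization_torusMk, periodization]
    simp
  rw [← h0, ← key]
  refine tsum_congr fun k => ?_
  rw [mFourier_torusMk]
  simp only [Pi.zero_apply, mul_zero, Finset.sum_const_zero, ofReal_zero, zero_mul,
    Complex.exp_zero, smul_eq_mul, mul_one]
  exact mFourierCoeff_torusPeriodization G k

end poisson

section selfdual

variable {ι : Type*} [Fintype ι]
  {E : Type*} [NormedAddCommGroup E] [InnerProductSpace ℝ E]

theorem hasTemperateGrowth_character (μ : E) :
    (fun x : E => cexp ((2 * π * ⟪x, μ⟫_ℝ : ℝ) * I)).HasTemperateGrowth :=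
  hasTemperateGrowth_cexp_ofReal_mul_I
    ((Function.HasTemperateGrowth.const (2 * π)).mul (Function.hasTemperateGrowth_inner_left μ))

variable [FiniteDimensional ℝ E] [MeasurableSpace E] [BorelSpace E]

/-- Poisson summation with characters for the image under `L` of the integer lattice, when that
image is self-dual: `L` preserves the volume and its Gram matrix induces a permutation `A` of the
integer vectors. -/
theorem tsum_character_eq (L : (ι → ℝ) ≃L[ℝ] E) (hL : MeasurePreserving L)
    (A : (ι → ℤ) ≃ (ι → ℤ)) (hA : ∀ k x, ⟪L (intVec k), L x⟫_ℝ = ∑ i, A k i * x i)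
    (H : 𝓢(E, ℂ)) (lam mu : E) :
    ∑' n : ι → ℤ, cexp ((2 * π * ⟪L (intVec n), mu⟫_ℝ : ℝ) * I) * H (L (intVec n) + lam) =
      cexp (-(2 * π * ⟪mu, lam⟫_ℝ : ℝ) * I) *
        ∑' k : ι → ℤ, cexp ((2 * π * ⟪L (intVec k), lam⟫_ℝ : ℝ) * I) *
          𝓕 H (L (intVec k) - mu) := by
  let G : 𝓢(ι → ℝ, ℂ) := SchwartzMap.compCLMOfContinuousLinearEquiv ℂ L
    (SchwartzMap.smulLeftCLM ℂ (fun x : E => cexp ((2 * π * ⟪x, mu⟫_ℝ : ℝ) * I))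
      (SchwartzMap.compSubConstCLM ℂ (-lam) H))
  have hG (x : ι → ℝ) : G x = cexp ((2 * π * ⟪L x, mu⟫_ℝ : ℝ) * I) * H (L x + lam) := by
    rw [SchwartzMap.compCLMOfContinuousLinearEquiv_apply, Function.comp_apply,
      SchwartzMap.smulLeftCLM_apply_apply (hasTemperateGrowth_character mu),
      SchwartzMap.compSubConstCLM_apply, sub_neg_eq_add, smul_eq_mul]
  have hcoef (k : ι → ℤ) : ∫ x : ι → ℝ, cexp (-(2 * π * ∑ i, A k i * x i : ℝ) * I) * G x =
      cexp (-(2 * π * ⟪mu, lam⟫_ℝ : ℝ) * I) * (cexp ((2 * π * ⟪L (intVec k), lam⟫_ℝ : ℝ) * I) *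
          𝓕 H (L (intVec k) - mu)) := by
    calc _ = ∫ x, cexp (-(2 * π * ⟪L x, L (intVec k) - mu⟫_ℝ : ℝ) * I) * H (L x + lam) := by
          congr 1
          funext x
          rw [hG, ← hA, ← mul_assoc, ← Complex.exp_add, inner_sub_right,
            real_inner_comm (L x) (L (intVec k))]
          congr 2
          push_cast
          ring
      _ = ∫ z, cexp (-(2 * π * ⟪z, L (intVec k) - mu⟫_ℝ : ℝ) * I) * H (z + lam) :=
          hL.integral_comp L.toHomeomorph.measurableEmbedding
            fun z => cexp (-(2 * π * ⟪z, L (intVec k) - mu⟫_ℝ : ℝ) * I) * H (z + lam)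
      _ = ∫ z, cexp (-(2 * π * ⟪z - lam, L (intVec k) - mu⟫_ℝ : ℝ) * I) * H z := by
          rw [← integral_sub_right_eq_self _ lam]
          simp
      _ = _ := by
          rw [SchwartzMap.fourier_coe, Real.fourier_eq', ← mul_assoc, ← integral_const_mul]
          congr 1
          funext z
          rw [smul_eq_mul, ← mul_assoc, ← Complex.exp_add, ← Complex.exp_add, inner_sub_left,
            inner_sub_right lam, real_inner_comm mu lam, real_inner_comm lam (L (intVec k))]
          congr 2
          push_cast
          ring
  have hsum : Summable fun k : ι → ℤ => cexp (-(2 * π * ⟪mu, lam⟫_ℝ : ℝ) * I) *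
      (cexp ((2 * π * ⟪L (intVec k), lam⟫_ℝ : ℝ) * I) * 𝓕 H (L (intVec k) - mu)) := by
    refine Summable.mul_left _ ?_
    have h1 := summable_intVec (SchwartzMap.compCLMOfContinuousLinearEquiv ℂ L
      (SchwartzMap.compSubConstCLM ℂ mu (𝓕 H)))
    refine Summable.of_norm_bounded h1.norm fun k => ?_
    rw [norm_mul, Complex.norm_exp_ofReal_mul_I, one_mul]
    rfl
  have hsum' : Summable fun k : ι → ℤ =>
      ∫ x : ι → ℝ, cexp (-(2 * π * ∑ i, k i * x i : ℝ) * I) * G x := by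
    rw [← A.summable_iff]
    exact hsum.congr fun k => (hcoef k).symm
  have key := tsum_intVec_eq_tsum_integral G hsum'
  simp_rw [hG] at key
  rw [key, ← A.tsum_eq, ← tsum_mul_left]
  refine tsum_congr fun k => ?_
  simp_rw [← hG]
  exact hcoef k

end selfdual

/-! ### Matrices as a Euclidean space -/

section flatten

variable {m n : ℕ}

/-- The entries of a matrix as a vector indexed by pairs. -/
def flatten {R : Type} : Mat m n R ≃ (Fin m × Fin n → R) where
  toFun x p := x p.1 p.2
  invFun y := Matrix.of fun i j => y (i, j)
  left_inv _ := rfl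
  right_inv _ := rfl

theorem flatten_apply {R : Type} (x : Mat m n R) (p : Fin m × Fin n) :
    flatten x p = x p.1 p.2 := rfl

/-- `flatten` for real matrices as a continuous linear equivalence. -/
def flattenCLE : Mat m n ℝ ≃L[ℝ] (Fin m × Fin n → ℝ) :=
  LinearEquiv.toContinuousLinearEquiv
    { flatten with
      map_add' := fun _ _ => rfl
      map_smul' := fun _ _ => rfl }

/-- Lebesgue measure on the entries is the same for curried and uncurried indexing. -/
theorem measurePreserving_flatten_of :
    MeasurePreserving fun y : Fin m → Fin n → ℝ => flatten (Matrix.of y) := by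
  have hmeas : Measurable fun y : Fin m → Fin n → ℝ => flatten (Matrix.of y) :=
    measurable_pi_lambda _ fun p => (measurable_pi_apply p.2).comp (measurable_pi_apply p.1)
  refine ⟨hmeas, (Measure.pi_eq fun s hs => ?_).symm⟩
  rw [Measure.map_apply hmeas (MeasurableSet.univ_pi hs)]
  have hpre : (fun y : Fin m → Fin n → ℝ => flatten (Matrix.of y)) ⁻¹' Set.univ.pi s =
      Set.univ.pi fun i => Set.univ.pi fun j => s (i, j) := by
    ext y
    simp [flatten_apply, Set.mem_pi]
  rw [hpre, volume_pi_pi, Fintype.prod_prod_type]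
  exact Finset.prod_congr rfl fun i _ => volume_pi_pi _

open scoped MatrixOrder Matrix.Norms.L2Operator in
theorem exists_eq_transpose_mul_self {M : Matrix (Fin m) (Fin m) ℝ} (hM : M.PosDef) :
    ∃ B : Matrix (Fin m) (Fin m) ℝ, M = B.transpose * B := by
  obtain ⟨B, hB⟩ := CStarAlgebra.nonneg_iff_eq_star_mul_self.mp hM.posSemidef.nonneg
  exact ⟨B, by rw [hB, Matrix.star_eq_conjTranspose, Matrix.conjTranspose_eq_transpose_of_trivial]⟩

open scoped Kronecker in
/-- A volume preserving identification of the space of matrices with a Euclidean space which turns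
the bilinear form attached to `M` into the inner product. -/
theorem exists_isometry (n : ℕ) {M : Matrix (Fin m) (Fin m) ℝ} (hM : M.PosDef) (hdet : M.det = 1) :
    ∃ L : (Fin m × Fin n → ℝ) ≃L[ℝ] EuclideanSpace ℝ (Fin m × Fin n),
      MeasurePreserving L ∧
      ∀ x y : Mat m n ℝ, ⟪L (flatten x), L (flatten y)⟫_ℝ = form M x y := by
  obtain ⟨B, hB⟩ := exists_eq_transpose_mul_self hM
  have hBdet : |B.det| = 1 := by
    rw [hB, Matrix.det_mul, Matrix.det_transpose] at hdet
    rw [← sq_eq_sq₀ (abs_nonneg _) zero_le_one, sq_abs, one_pow, sq, hdet]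
  set K : Matrix (Fin m × Fin n) (Fin m × Fin n) ℝ := B ⊗ₖ (1 : Matrix (Fin n) (Fin n) ℝ) with hK
  have hKdet : |K.det| = 1 := by
    rw [hK, Matrix.det_kronecker, Matrix.det_one, one_pow, mul_one, abs_pow, hBdet, one_pow]
  have hK0 : K.det ≠ 0 := fun h => by simp [h] at hKdet
  have hunit : IsUnit (LinearMap.det (Matrix.toLin' K)) := by
    rw [LinearMap.det_toLin']
    exact hK0.isUnit
  let L₀ : (Fin m × Fin n → ℝ) ≃ₗ[ℝ] (Fin m × Fin n → ℝ) := LinearMap.equivOfIsUnitDet hunit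
  have hL₀ (x : Fin m × Fin n → ℝ) : L₀ x = Matrix.toLin' K x :=
    LinearMap.equivOfIsUnitDet_apply hunit x
  refine ⟨L₀.toContinuousLinearEquiv.trans (PiLp.continuousLinearEquiv 2 ℝ fun _ => ℝ).symm,
    ?_, fun x y => ?_⟩
  · have h1 : MeasurePreserving (Matrix.toLin' K) volume volume := by
      refine ⟨(Matrix.toLin' K).continuous_of_finiteDimensional.measurable, ?_⟩
      rw [Real.map_matrix_volume_pi_eq_smul_volume_pi hK0, abs_inv, hKdet]
      simp
    rw [← show ⇑L₀ = Matrix.toLin' K from funext hL₀] at h1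
    exact (PiLp.volume_preserving_toLp (Fin m × Fin n)).comp h1
  · have h2 (z : Mat m n ℝ) (p : Fin m × Fin n) :
        Matrix.toLin' K (flatten z) p = (B * z) p.1 p.2 := by
      rw [Matrix.toLin'_apply, Matrix.mulVec, dotProduct, Fintype.sum_prod_type, Matrix.mul_apply]
      refine Finset.sum_congr rfl fun i _ => ?_
      simp [hK, flatten_apply, Matrix.one_apply]
    change ⟪WithLp.toLp 2 (L₀ (flatten x)), WithLp.toLp 2 (L₀ (flatten y))⟫_ℝ = _
    rw [PiLp.inner_apply, form, hB]
    simp only [hL₀, h2, RCLike.inner_apply, conj_trivial]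
    have h3 : x.transpose * (B.transpose * B) * y = (B * x).transpose * (B * y) := by
      simp only [Matrix.transpose_mul, Matrix.mul_assoc]
    rw [h3, Fintype.sum_prod_type, Finset.sum_comm, Matrix.trace]
    refine Finset.sum_congr rfl fun j _ => ?_
    rw [Matrix.diag_apply, Matrix.mul_apply]
    exact Finset.sum_congr rfl fun i _ => by rw [Matrix.transpose_apply, mul_comm]

end flatten

/-! ### Theta sums as sums over a self-dual lattice -/

section theta

variable {m n : ℕ}

/-- An integral matrix regarded as a real one. -/
abbrev castMat (ω : Mat m n ℤ) : Mat m n ℝ := ω.map (Int.cast : ℤ → ℝ)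

theorem flatten_castMat (ω : Mat m n ℤ) : flatten (castMat ω) = intVec (flatten ω) := rfl

theorem castMat_add (ω ω' : Mat m n ℤ) : castMat (ω + ω') = castMat ω + castMat ω' := by
  ext i j
  simp

theorem form_castMat (M : Matrix (Fin m) (Fin m) ℤ) (ω ω' : Mat m n ℤ) :
    form (M.map (Int.cast : ℤ → ℝ)) (castMat ω) (castMat ω') =
      ((ω.transpose * M * ω').trace : ℤ) := by
  simp [form, Matrix.trace, Matrix.mul_apply]

theorem det_map_intCast_eq_one {M : Matrix (Fin m) (Fin m) ℤ}
    (hpos : (M.map (Int.cast : ℤ → ℝ)).PosDef) (huni : IsUnit M.det) :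
    (M.map (Int.cast : ℤ → ℝ)).det = 1 := by
  have h1 : (M.map (Int.cast : ℤ → ℝ)).det = (M.det : ℝ) :=
    (RingHom.map_det (Int.castRingHom ℝ) M).symm
  have h2 := hpos.det_pos
  rw [h1] at h2 ⊢
  rcases Int.isUnit_iff.1 huni with h | h
  · rw [h, Int.cast_one]
  · rw [h] at h2
    norm_num at h2

/-- For symmetric unimodular `M`, multiplication by `M` is a permutation of the integer vectors
which expresses the form attached to `M` through the standard pairing. -/
theorem exists_dual_equiv (n : ℕ) {M : Matrix (Fin m) (Fin m) ℤ} (hsymm : M.IsSymm)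
    (huni : IsUnit M.det) :
    ∃ A : (Fin m × Fin n → ℤ) ≃ (Fin m × Fin n → ℤ), ∀ (ω : Mat m n ℤ) (x : Mat m n ℝ),
      form (M.map (Int.cast : ℤ → ℝ)) (castMat ω) x = ∑ p, A (flatten ω) p * flatten x p := by
  let e : Mat m n ℤ ≃ Mat m n ℤ :=
    { toFun := fun ω => M * ω
      invFun := fun ω => M⁻¹ * ω
      left_inv := fun ω => Matrix.nonsing_inv_mul_cancel_left _ ω huni
      right_inv := fun ω => Matrix.mul_nonsing_inv_cancel_left _ ω huni }
  refine ⟨(flatten.symm.trans e).trans flatten, fun ω x => ?_⟩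
  simp only [Equiv.trans_apply, Equiv.symm_apply_apply]
  change _ = ∑ p : Fin m × Fin n, (((M * ω) p.1 p.2 : ℤ) : ℝ) * x p.1 p.2
  have h1 : (castMat ω).transpose * M.map (Int.cast : ℤ → ℝ) = (castMat (M * ω)).transpose := by
    ext j i
    simp only [castMat, Matrix.mul_apply, Matrix.transpose_apply, Matrix.map_apply, Int.cast_sum,
      Int.cast_mul]
    exact Finset.sum_congr rfl fun k _ => by rw [mul_comm, hsymm.apply]
  rw [form, h1, Fintype.sum_prod_type, Finset.sum_comm, Matrix.trace]
  refine Finset.sum_congr rfl fun j _ => ?_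
  rw [Matrix.diag_apply, Matrix.mul_apply]
  rfl

variable {M : Matrix (Fin m) (Fin m) ℝ}
  {L : (Fin m × Fin n → ℝ) ≃L[ℝ] EuclideanSpace ℝ (Fin m × Fin n)}

theorem integral_comp_flatten_of (hL : MeasurePreserving L)
    (F : EuclideanSpace ℝ (Fin m × Fin n) → ℂ) :
    ∫ y : Fin m → Fin n → ℝ, F (L (flatten (Matrix.of y))) = ∫ z, F z := by
  have hemb : MeasurableEmbedding fun y : Fin m → Fin n → ℝ => flatten (Matrix.of y) := by
    refine Continuous.measurableEmbedding ?_ fun x y h => flatten.injective h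
    exact continuous_pi fun p => (continuous_apply p.2).comp (continuous_apply p.1)
  rw [← hL.integral_comp L.toHomeomorph.measurableEmbedding F]
  exact measurePreserving_flatten_of.integral_comp hemb fun x => F (L x)

/-- A Schwartz function of a matrix, transported to the Euclidean space. -/
def transport (L : (Fin m × Fin n → ℝ) ≃L[ℝ] EuclideanSpace ℝ (Fin m × Fin n))
    (f : 𝓢(Mat m n ℝ, ℂ)) : 𝓢(EuclideanSpace ℝ (Fin m × Fin n), ℂ) :=
  SchwartzMap.compCLMOfContinuousLinearEquiv ℂ (flattenCLE.trans L).symm f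

theorem transport_apply (f : 𝓢(Mat m n ℝ, ℂ)) (x : Mat m n ℝ) :
    transport L f (L (flatten x)) = f x := by
  change f ((flattenCLE.trans L).symm ((flattenCLE.trans L) x)) = f x
  rw [ContinuousLinearEquiv.symm_apply_apply]

theorem apply_flatten_add (x y : Mat m n ℝ) :
    L (flatten (x + y)) = L (flatten x) + L (flatten y) :=
  map_add (flattenCLE.trans L) x y

theorem apply_flatten_smul (c : ℝ) (x : Mat m n ℝ) : L (flatten (c • x)) = c • L (flatten x) :=
  map_smul (flattenCLE.trans L) c x

theorem apply_flatten_neg (x : Mat m n ℝ) : L (flatten (-x)) = -L (flatten x) :=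
  map_neg (flattenCLE.trans L) x

/-- The operator `R_M(i, φ)` becomes `rot φ` on the Euclidean space. -/
theorem weilRot_eq_rot (hdet : M.det = 1) (hL : MeasurePreserving L)
    (hform : ∀ x y : Mat m n ℝ, ⟪L (flatten x), L (flatten y)⟫_ℝ = form M x y)
    (φ : ℝ) (f : 𝓢(Mat m n ℝ, ℂ)) (x : Mat m n ℝ) :
    weilRot M φ f x = rot φ (transport L f) (L (flatten x)) := by
  have hc1 : (∃ k : ℤ, φ = 2 * π * k) ↔ Real.cos φ = 1 := by
    rw [Real.cos_eq_one_iff]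
    exact exists_congr fun k => by rw [eq_comm, mul_comm]
  have hc2 : (∃ k : ℤ, φ = π + 2 * π * k) ↔ Real.cos φ = -1 := by
    rw [Real.cos_eq_neg_one_iff]
    exact exists_congr fun k => by rw [eq_comm, mul_comm (2 * π)]
  have hsc := Real.sin_sq_add_cos_sq φ
  rw [weilRot]
  simp only [hc1, hc2]
  by_cases h1 : Real.cos φ = 1
  · have hs : Real.sin φ = 0 := by
      rw [h1] at hsc
      simpa using hsc
    rw [if_pos h1, rot, if_pos hs, h1, dilate_one, transport_apply]
  by_cases h2 : Real.cos φ = -1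
  · have hs : Real.sin φ = 0 := by
      rw [h2] at hsc
      simpa using hsc
    rw [if_neg h1, if_pos h2, rot, if_pos hs, h2, dilate_neg_one_apply, ← apply_flatten_neg,
      transport_apply]
  have hs : Real.sin φ ≠ 0 := by
    intro hs
    rw [hs] at hsc
    have : (Real.cos φ - 1) * (Real.cos φ + 1) = 0 := by linarith
    rcases mul_eq_zero.1 this with h | h
    · exact h1 (by linarith)
    · exact h2 (by linarith)
  have hfin : (Module.finrank ℝ (EuclideanSpace ℝ (Fin m × Fin n)) : ℝ) = m * n := by simp
  have hnorm (z : Mat m n ℝ) : form M z z = ‖L (flatten z)‖ ^ 2 := by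
    rw [← hform, real_inner_self_eq_norm_sq]
  rw [if_neg h1, if_neg h2, rot, if_neg hs, chirp_apply, dilate_apply (inv_ne_zero hs), hdet,
    Real.one_rpow, one_mul, hfin, SchwartzMap.fourier_coe, Real.fourier_eq',
    ← integral_comp_flatten_of hL, abs_inv, Real.inv_rpow (abs_nonneg _),
    ← Real.rpow_neg (abs_nonneg _), mul_left_comm, ← integral_const_mul (cexp _)]
  congr 2
  funext y
  rw [chirp_apply, transport_apply, smul_eq_mul, ← mul_assoc, ← mul_assoc, ← Complex.exp_add,
    ← Complex.exp_add, hnorm, hnorm, ← hform, real_inner_smul_right, real_inner_comm]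
  congr 2
  push_cast
  field_simp
  ring

theorem thetaTerm_eq (hdet : M.det = 1) (hL : MeasurePreserving L)
    (hform : ∀ x y : Mat m n ℝ, ⟪L (flatten x), L (flatten y)⟫_ℝ = form M x y)
    (f : 𝓢(Mat m n ℝ, ℂ)) (τ : ℍ) (φ : ℝ) (lam mu : Mat m n ℝ) (ω : Mat m n ℤ) :
    ((τ.im ^ ((m : ℝ) * n / 4) : ℝ) : ℂ) * thetaTerm M f τ φ lam mu ω =
      cexp ((2 * π * ⟪L (intVec (flatten ω)), L (flatten mu)⟫_ℝ : ℝ) * I) *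
        weilOp τ.re τ.im φ (transport L f) (L (intVec (flatten ω)) + L (flatten lam)) := by
  have hq : 0 < √τ.im := Real.sqrt_pos.2 τ.im_pos
  have hfin : (Module.finrank ℝ (EuclideanSpace ℝ (Fin m × Fin n)) : ℝ) = m * n := by simp
  rw [thetaTerm, weilRot_eq_rot hdet hL hform, weilOp, chirp_apply, dilate_apply hq.ne',
    abs_of_pos hq, hfin, Real.sqrt_eq_rpow, ← Real.rpow_mul τ.im_pos.le,
    ← flatten_castMat, hform, ← apply_flatten_add, ← hform (_ + _), real_inner_self_eq_norm_sq,
    apply_flatten_smul]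
  have h1 : (1 / 2 * ((m : ℝ) * n / 2)) = (m : ℝ) * n / 4 := by ring
  rw [h1]
  have h2 : cexp (π * I * ((τ.re * ‖L (flatten (castMat ω + lam))‖ ^ 2
      + 2 * form M (castMat ω) mu : ℝ) : ℂ)) =
      cexp ((2 * π * form M (castMat ω) mu : ℝ) * I) *
        cexp ((π * (τ.re * ‖L (flatten (castMat ω + lam))‖ ^ 2) : ℝ) * I) := by
    rw [← Complex.exp_add]
    congr 1
    push_cast
    ring
  rw [h2]
  ring

theorem summable_thetaTerm (hdet : M.det = 1) (hL : MeasurePreserving L)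
    (hform : ∀ x y : Mat m n ℝ, ⟪L (flatten x), L (flatten y)⟫_ℝ = form M x y)
    (f : 𝓢(Mat m n ℝ, ℂ)) (τ : ℍ) (φ : ℝ) (lam mu : Mat m n ℝ) :
    Summable (thetaTerm M f τ φ lam mu) := by
  have hv : (((τ.im ^ ((m : ℝ) * n / 4) : ℝ) : ℂ)) ≠ 0 :=
    ofReal_ne_zero.2 (Real.rpow_pos_of_pos τ.im_pos _).ne'
  rw [← summable_mul_left_iff hv]
  simp_rw [thetaTerm_eq hdet hL hform]
  have h1 := summable_intVec (SchwartzMap.compCLMOfContinuousLinearEquiv ℂ L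
    (SchwartzMap.compSubConstCLM ℂ (-L (flatten lam))
      (weilOp τ.re τ.im φ (transport L f))))
  refine Summable.of_norm_bounded (h1.norm.comp_injective flatten.injective) fun ω => ?_
  rw [norm_mul, Complex.norm_exp_ofReal_mul_I, one_mul]
  simp

/-- The theta sum is a sum of values of the Schwartz function `weilOp`, twisted by a character, over
the lattice `L (ℤ^{(m,n)})`. The factor `v^{mn/4}` is the normalization of `dilate (√v)`. -/
theorem theta_eq (hdet : M.det = 1) (hL : MeasurePreserving L)
    (hform : ∀ x y : Mat m n ℝ, ⟪L (flatten x), L (flatten y)⟫_ℝ = form M x y)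
    (f : 𝓢(Mat m n ℝ, ℂ)) (τ : ℍ) (φ : ℝ) (lam mu : Mat m n ℝ) :
    theta M f τ φ lam mu = ∑' k : Fin m × Fin n → ℤ,
      cexp ((2 * π * ⟪L (intVec k), L (flatten mu)⟫_ℝ : ℝ) * I) *
        weilOp τ.re τ.im φ (transport L f) (L (intVec k) + L (flatten lam)) := by
  rw [theta, ← tsum_mul_left, ← flatten.tsum_eq]
  exact tsum_congr fun ω => thetaTerm_eq hdet hL hform f τ φ lam mu ω

end theta

/-! ### Behaviour of the theta sums under the generators -/

section invariance

variable {m n : ℕ} {M : Matrix (Fin m) (Fin m) ℤ}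
  {L : (Fin m × Fin n → ℝ) ≃L[ℝ] EuclideanSpace ℝ (Fin m × Fin n)}

theorem cexp_two_pi_intCast (k : ℤ) : cexp ((2 * π * k : ℝ) * I) = 1 := by
  rw [← Complex.exp_int_mul_two_pi_mul_I k]
  congr 1
  push_cast
  ring

/-- Integral translations multiply the theta sum by a unimodular factor. -/
theorem theta_add_castMat (hdet : (M.map (Int.cast : ℤ → ℝ)).det = 1) (hL : MeasurePreserving L)
    (hform : ∀ x y : Mat m n ℝ,
      ⟪L (flatten x), L (flatten y)⟫_ℝ = form (M.map (Int.cast : ℤ → ℝ)) x y)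
    (f : 𝓢(Mat m n ℝ, ℂ)) (τ : ℍ) (φ : ℝ) (lam mu : Mat m n ℝ) (lam₀ mu₀ : Mat m n ℤ) :
    theta (M.map (Int.cast : ℤ → ℝ)) f τ φ (lam + castMat lam₀) (mu + castMat mu₀) =
      cexp ((-(2 * π * form (M.map (Int.cast : ℤ → ℝ)) (castMat lam₀) mu) : ℝ) * I) *
        theta (M.map (Int.cast : ℤ → ℝ)) f τ φ lam mu := by
  rw [theta_eq hdet hL hform, theta_eq hdet hL hform, ← tsum_mul_left,
    ← (flatten.symm.trans ((Equiv.addRight lam₀).trans flatten)).tsum_eq fun k => _ * (_ * _)]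
  refine tsum_congr fun k => ?_
  obtain ⟨ω, rfl⟩ := flatten.surjective k
  simp only [Equiv.trans_apply, Equiv.symm_apply_apply, Equiv.coe_addRight, ← flatten_castMat,
    castMat_add, apply_flatten_add]
  rw [← mul_assoc, ← Complex.exp_add, add_assoc (L _), add_comm (L (flatten (castMat lam₀)))]
  congr 1
  rw [inner_add_right, inner_add_left, hform, hform, hform, form_castMat,
    ← mul_one (cexp (_ + _)), ← cexp_two_pi_intCast (ω.transpose * M * mu₀).trace,
    ← Complex.exp_add]
  congr 1
  push_cast
  ring

/-- The action of `(T_*, (0, s))` multiplies the theta sum by a unimodular factor. -/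
theorem theta_add_two (hdet : (M.map (Int.cast : ℤ → ℝ)).det = 1) (hL : MeasurePreserving L)
    (hform : ∀ x y : Mat m n ℝ,
      ⟪L (flatten x), L (flatten y)⟫_ℝ = form (M.map (Int.cast : ℤ → ℝ)) x y)
    (f : 𝓢(Mat m n ℝ, ℂ)) {τ τ' : ℍ} (hre : τ'.re = τ.re + 2) (him : τ'.im = τ.im)
    (φ : ℝ) (lam mu : Mat m n ℝ) (s : Mat m n ℤ) :
    theta (M.map (Int.cast : ℤ → ℝ)) f τ' φ lam (mu + (-2 : ℝ) • lam + castMat s) =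
      cexp ((2 * π * form (M.map (Int.cast : ℤ → ℝ)) lam lam : ℝ) * I) *
        theta (M.map (Int.cast : ℤ → ℝ)) f τ φ lam mu := by
  rw [theta_eq hdet hL hform, theta_eq hdet hL hform, ← tsum_mul_left]
  refine tsum_congr fun k => ?_
  obtain ⟨ω, rfl⟩ := flatten.surjective k
  rw [hre, him, add_comm τ.re, weilOp, ← chirp_chirp, ← weilOp, chirp_apply,
    ← mul_assoc (cexp _), ← mul_assoc (cexp _), ← flatten_castMat]
  congr 1
  rw [← Complex.exp_add, ← Complex.exp_add]
  simp only [apply_flatten_add, apply_flatten_smul]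
  rw [← real_inner_self_eq_norm_sq]
  simp only [inner_add_left, inner_add_right, real_inner_smul_right]
  rw [real_inner_comm (L (flatten (castMat ω))) (L (flatten lam))]
  simp only [hform, form_castMat]
  rw [← mul_one (cexp (_ + ((2 * π * form _ _ mu : ℝ) : ℂ) * I)),
    ← cexp_two_pi_intCast ((ω.transpose * M * s).trace + (ω.transpose * M * ω).trace),
    ← Complex.exp_add]
  congr 1
  push_cast
  ring

/-- The action of `S` multiplies the theta sum by a unimodular factor independent of the
function. -/
theorem exists_theta_S (hsymm : M.IsSymm) (huni : IsUnit M.det)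
    (hdet : (M.map (Int.cast : ℤ → ℝ)).det = 1) (hL : MeasurePreserving L)
    (hform : ∀ x y : Mat m n ℝ,
      ⟪L (flatten x), L (flatten y)⟫_ℝ = form (M.map (Int.cast : ℤ → ℝ)) x y)
    {τ τ' : ℍ} (hre : τ'.re = -τ.re / (τ.re ^ 2 + τ.im ^ 2))
    (him : τ'.im = τ.im / (τ.re ^ 2 + τ.im ^ 2)) {φ φ' : ℝ}
    (hs : Real.sin φ' = (τ.re * Real.sin φ + τ.im * Real.cos φ) / √(τ.re ^ 2 + τ.im ^ 2))
    (hc : Real.cos φ' = (τ.re * Real.cos φ - τ.im * Real.sin φ) / √(τ.re ^ 2 + τ.im ^ 2))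
    (lam mu : Mat m n ℝ) :
    ∃ c : ℂ, ‖c‖ = 1 ∧ ∀ f : 𝓢(Mat m n ℝ, ℂ),
      theta (M.map (Int.cast : ℤ → ℝ)) f τ' φ' (-mu) lam =
        c * theta (M.map (Int.cast : ℤ → ℝ)) f τ φ lam mu := by
  obtain ⟨κ, hκ, hF⟩ :=
    fourier_weilOp (E := EuclideanSpace ℝ (Fin m × Fin n)) τ.im_pos hs hc
  have hκ0 : κ ≠ 0 := fun h => by simp [h] at hκ
  obtain ⟨A, hA⟩ := exists_dual_equiv n hsymm huni
  have hA' (k : Fin m × Fin n → ℤ) (x : Fin m × Fin n → ℝ) :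
      ⟪L (intVec k), L x⟫_ℝ = ∑ p, A k p * x p := by
    obtain ⟨ω, rfl⟩ := flatten.surjective k
    obtain ⟨y, rfl⟩ := flatten.surjective x
    rw [← flatten_castMat, hform, hA]
  set z : ℂ := -(2 * π * ⟪L (flatten mu), L (flatten lam)⟫_ℝ : ℝ) * I with hz
  have hz1 : ‖cexp z‖ = 1 := by
    rw [hz, ← ofReal_neg]
    exact Complex.norm_exp_ofReal_mul_I _
  refine ⟨(cexp z * κ)⁻¹, by rw [norm_inv, norm_mul, hκ, hz1]; norm_num, fun f => ?_⟩
  have key := tsum_character_eq L hL A hA' (weilOp τ.re τ.im φ (transport L f))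
    (L (flatten lam)) (L (flatten mu))
  rw [theta_eq hdet hL hform, theta_eq hdet hL hform, key, eq_inv_mul_iff_mul_eq₀
    (mul_ne_zero (Complex.exp_ne_zero _) hκ0), mul_assoc, ← tsum_mul_left]
  congr 1
  refine tsum_congr fun k => ?_
  rw [hF, smul_apply, smul_eq_mul, hre, him, apply_flatten_neg, ← sub_eq_add_neg]
  ring

end invariance

/-! ### Iwasawa coordinates -/

section iwasawa

/-- The Iwasawa decomposition, entry by entry. -/
theorem iwasawa_entries (g : SL(2, ℝ)) :
    g 0 0 = √(iwasawaTau g).im * Real.cos (iwasawaPhi g) +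
        (iwasawaTau g).re * Real.sin (iwasawaPhi g) / √(iwasawaTau g).im ∧
      g 0 1 = (iwasawaTau g).re * Real.cos (iwasawaPhi g) / √(iwasawaTau g).im -
        √(iwasawaTau g).im * Real.sin (iwasawaPhi g) ∧
      g 1 0 = Real.sin (iwasawaPhi g) / √(iwasawaTau g).im ∧
      g 1 1 = Real.cos (iwasawaPhi g) / √(iwasawaTau g).im := by
  have h := iwasawa_decomposition g
  refine ⟨(congrFun (congrFun h 0) 0).trans ?_, (congrFun (congrFun h 0) 1).trans ?_,
    (congrFun (congrFun h 1) 0).trans ?_, (congrFun (congrFun h 1) 1).trans ?_⟩ <;>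
  simp [Matrix.mul_apply, Fin.sum_univ_two] <;> ring

/-- `S` as a real matrix. -/
def realS : SL(2, ℝ) := matS.map (Int.castRingHom ℝ)

/-- `T_*` as a real matrix. -/
def realTstar : SL(2, ℝ) := matTstar.map (Int.castRingHom ℝ)

theorem coe_realS : (realS : Matrix (Fin 2) (Fin 2) ℝ) = !![0, -1; 1, 0] := by
  ext i j
  change ((matS i j : ℤ) : ℝ) = _
  fin_cases i <;> fin_cases j <;> simp [matS]

theorem coe_realTstar : (realTstar : Matrix (Fin 2) (Fin 2) ℝ) = !![1, 2; 0, 1] := by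
  ext i j
  change ((matTstar i j : ℤ) : ℝ) = _
  fin_cases i <;> fin_cases j <;> simp [matTstar]

theorem iwasawaTau_mul (h g : SL(2, ℝ)) : iwasawaTau (h * g) = h • iwasawaTau g :=
  mul_smul h g _

theorem coe_iwasawaTau_Tstar_mul (g : SL(2, ℝ)) :
    (iwasawaTau (realTstar * g) : ℂ) = iwasawaTau g + 2 := by
  rw [iwasawaTau_mul, UpperHalfPlane.specialLinearGroup_apply]
  simp [coe_realTstar]

theorem coe_iwasawaTau_S_mul (g : SL(2, ℝ)) :
    (iwasawaTau (realS * g) : ℂ) = -(iwasawaTau g : ℂ)⁻¹ := by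
  rw [iwasawaTau_mul, UpperHalfPlane.specialLinearGroup_apply]
  simp [coe_realS, neg_div]

theorem iwasawaPhi_Tstar_mul (g : SL(2, ℝ)) : iwasawaPhi (realTstar * g) = iwasawaPhi g := by
  have h1 : (realTstar * g) 1 0 = g 1 0 := by
    simp [coe_realTstar, Matrix.mul_apply, Fin.sum_univ_two]
  have h2 : (realTstar * g) 1 1 = g 1 1 := by
    simp [coe_realTstar, Matrix.mul_apply, Fin.sum_univ_two]
  rw [iwasawaPhi, iwasawaPhi, h1, h2]

theorem re_iwasawaTau_S_mul (g : SL(2, ℝ)) : (iwasawaTau (realS * g)).re =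
    -(iwasawaTau g).re / ((iwasawaTau g).re ^ 2 + (iwasawaTau g).im ^ 2) := by
  have h := congrArg Complex.re (coe_iwasawaTau_S_mul g)
  rw [Complex.neg_re, Complex.inv_re, Complex.normSq_apply, ← sq, ← sq, ← neg_div] at h
  exact h

theorem im_iwasawaTau_S_mul (g : SL(2, ℝ)) : (iwasawaTau (realS * g)).im =
    (iwasawaTau g).im / ((iwasawaTau g).re ^ 2 + (iwasawaTau g).im ^ 2) := by
  have h := congrArg Complex.im (coe_iwasawaTau_S_mul g)
  rw [Complex.neg_im, Complex.inv_im, Complex.normSq_apply, ← sq, ← sq, ← neg_div, neg_neg] at h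
  exact h

/-- Left multiplication by `S` replaces `φ` by `φ + arg τ`, modulo `2π`. -/
theorem sin_cos_iwasawaPhi_S_mul (g : SL(2, ℝ)) :
    Real.sin (iwasawaPhi (realS * g)) =
        ((iwasawaTau g).re * Real.sin (iwasawaPhi g) + (iwasawaTau g).im *
          Real.cos (iwasawaPhi g)) / √((iwasawaTau g).re ^ 2 + (iwasawaTau g).im ^ 2) ∧
      Real.cos (iwasawaPhi (realS * g)) =
        ((iwasawaTau g).re * Real.cos (iwasawaPhi g) - (iwasawaTau g).im *
          Real.sin (iwasawaPhi g)) / √((iwasawaTau g).re ^ 2 + (iwasawaTau g).im ^ 2) := by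
  obtain ⟨h00, h01, -, -⟩ := iwasawa_entries g
  obtain ⟨-, -, h10, h11⟩ := iwasawa_entries (realS * g)
  have e1 : (realS * g) 1 0 = g 0 0 := by
    simp [coe_realS, Matrix.mul_apply, Fin.sum_univ_two]
  have e2 : (realS * g) 1 1 = g 0 1 := by
    simp [coe_realS, Matrix.mul_apply, Fin.sum_univ_two]
  have hv := (iwasawaTau g).im_pos
  have hN : 0 < (iwasawaTau g).re ^ 2 + (iwasawaTau g).im ^ 2 := by positivity
  have hq := Real.sqrt_pos.2 hv
  have hr := Real.sqrt_pos.2 hN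
  have hq2 := Real.sq_sqrt hv.le
  rw [e1, h00, im_iwasawaTau_S_mul, Real.sqrt_div hv.le] at h10
  rw [e2, h01, im_iwasawaTau_S_mul, Real.sqrt_div hv.le] at h11
  generalize √((iwasawaTau g).re ^ 2 + (iwasawaTau g).im ^ 2) = r at *
  generalize √(iwasawaTau g).im = q at *
  have hq0 := hq.ne'
  have hr0 := hr.ne'
  rw [eq_div_iff (div_ne_zero hq0 hr0)] at h10 h11
  rw [← h10, ← h11, ← hq2]
  constructor
  · field_simp
    ring
  · field_simp

end iwasawa

/-! ### Invariance under the group -/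

section group

variable {m n : ℕ}

/-- An integral element `γ` multiplies all theta sums by a common unimodular factor. -/
def HasPhase (M : Matrix (Fin m) (Fin m) ℝ) (γ : JacobiGroup m n ℤ) : Prop :=
  ∀ x : JacobiGroup m n ℝ, ∃ c : ℂ, ‖c‖ = 1 ∧ ∀ f : 𝓢(Mat m n ℝ, ℂ),
    thetaFun M f (toReal γ * x) = c * thetaFun M f x

theorem toReal_one : toReal (1 : JacobiGroup m n ℤ) = 1 := by
  apply JacobiGroup.ext
  · simp [toReal, one_def]
  · ext i j <;> simp [toReal, one_def]

theorem toReal_mul_toReal_inv (γ : JacobiGroup m n ℤ) : toReal γ * toReal γ⁻¹ = 1 := by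
  rw [← toReal_mul, mul_inv_cancel, toReal_one]

theorem HasPhase.one (M : Matrix (Fin m) (Fin m) ℝ) :
    HasPhase M (1 : JacobiGroup m n ℤ) := fun x =>
  ⟨1, norm_one, fun f => by rw [toReal_one, one_mul, one_mul]⟩

theorem HasPhase.mul {M : Matrix (Fin m) (Fin m) ℝ} {γ δ : JacobiGroup m n ℤ}
    (hγ : HasPhase M γ) (hδ : HasPhase M δ) : HasPhase M (γ * δ) := fun x => by
  obtain ⟨c, hc, hcf⟩ := hγ (toReal δ * x)
  obtain ⟨d, hd, hdf⟩ := hδ x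
  exact ⟨c * d, by rw [norm_mul, hc, hd, one_mul], fun f => by
    rw [toReal_mul, mul_assoc, hcf, hdf, mul_assoc]⟩

theorem HasPhase.inv {M : Matrix (Fin m) (Fin m) ℝ} {γ : JacobiGroup m n ℤ}
    (hγ : HasPhase M γ) : HasPhase M γ⁻¹ := fun x => by
  obtain ⟨c, hc, hcf⟩ := hγ (toReal γ⁻¹ * x)
  have hc0 : c ≠ 0 := fun h => by simp [h] at hc
  refine ⟨c⁻¹, by rw [norm_inv, hc, inv_one], fun f => ?_⟩
  rw [eq_inv_mul_iff_mul_eq₀ hc0, ← hcf, ← mul_assoc, toReal_mul_toReal_inv, one_mul]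

/-- Left multiplication in the coordinates `(λ, μ)`. -/
theorem pairMul_toReal_mul (γ : JacobiGroup m n ℤ) (x : JacobiGroup m n ℝ) :
    pairMul (toReal γ * x).vec (toReal γ * x).sl⁻¹ =
      pairMul ((toReal γ).vec + pairMul x.vec x.sl⁻¹) (toReal γ).sl⁻¹ := by
  rw [mul_def]
  simp only
  rw [mul_inv_rev, pairMul_mul, pairMul_add, ← pairMul_mul, mul_inv_cancel, pairMul_one]

theorem hasPhase_of_mem_Gamma2 {M : Matrix (Fin m) (Fin m) ℤ} (hsymm : M.IsSymm)
    (hpos : (M.map (Int.cast : ℤ → ℝ)).PosDef) (huni : IsUnit M.det)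
    {γ : JacobiGroup m n ℤ} (hγ : γ ∈ Gamma2 m n) :
    HasPhase (M.map (Int.cast : ℤ → ℝ)) γ := by
  have hdet := det_map_intCast_eq_one hpos huni
  obtain ⟨L, hL, hform⟩ := exists_isometry n hpos hdet
  refine Subgroup.closure_induction (p := fun γ _ => HasPhase (M.map (Int.cast : ℤ → ℝ)) γ)
    (fun γ hγ => ?_) (HasPhase.one _) (fun _ _ _ _ => HasPhase.mul) (fun _ _ => HasPhase.inv) hγ
  intro x
  have hp := pairMul_toReal_mul γ x
  simp only [thetaFun]
  rw [hp]
  generalize pairMul x.vec x.sl⁻¹ = p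
  rcases hγ with (hγ | ⟨s, rfl⟩) | ⟨q, rfl⟩
  · rw [Set.mem_singleton_iff] at hγ
    subst hγ
    obtain ⟨hs, hc⟩ := sin_cos_iwasawaPhi_S_mul x.sl
    obtain ⟨c, hc1, hcf⟩ := exists_theta_S hsymm huni hdet hL hform (re_iwasawaTau_S_mul x.sl)
      (im_iwasawaTau_S_mul x.sl) hs hc p.1 p.2
    refine ⟨c, hc1, fun f => ?_⟩
    rw [← hcf]
    have h1 : pairMul ((toReal (⟨matS, (0, 0)⟩ : JacobiGroup m n ℤ)).vec + p)
        (toReal (⟨matS, (0, 0)⟩ : JacobiGroup m n ℤ)).sl⁻¹ = (-p.2, p.1) := by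
      change pairMul _ realS⁻¹ = _
      ext i j <;>
      simp [toReal, pairMul, coe_realS, Matrix.SpecialLinearGroup.SL2_inv_expl]
    rw [h1]
    rfl
  · refine ⟨cexp ((2 * π * form (M.map (Int.cast : ℤ → ℝ)) p.1 p.1 : ℝ) * I),
      Complex.norm_exp_ofReal_mul_I _, fun f => ?_⟩
    have hre : (iwasawaTau (realTstar * x.sl)).re = (iwasawaTau x.sl).re + 2 := by
      simpa using congrArg Complex.re (coe_iwasawaTau_Tstar_mul x.sl)
    have him : (iwasawaTau (realTstar * x.sl)).im = (iwasawaTau x.sl).im := by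
      simpa using congrArg Complex.im (coe_iwasawaTau_Tstar_mul x.sl)
    rw [← theta_add_two hdet hL hform f hre him _ p.1 p.2 s]
    have h1 : pairMul ((toReal (⟨matTstar, (0, s)⟩ : JacobiGroup m n ℤ)).vec + p)
        (toReal (⟨matTstar, (0, s)⟩ : JacobiGroup m n ℤ)).sl⁻¹ =
        (p.1, p.2 + (-2 : ℝ) • p.1 + castMat s) := by
      change pairMul _ realTstar⁻¹ = _
      ext i j
      · simp [toReal, pairMul, coe_realTstar, Matrix.SpecialLinearGroup.SL2_inv_expl]
      · simp [toReal, pairMul, coe_realTstar, Matrix.SpecialLinearGroup.SL2_inv_expl]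
        ring
    rw [h1, ← iwasawaPhi_Tstar_mul x.sl]
    rfl
  · refine ⟨cexp ((-(2 * π * form (M.map (Int.cast : ℤ → ℝ)) (castMat q.1) p.2) : ℝ) * I),
      Complex.norm_exp_ofReal_mul_I _, fun f => ?_⟩
    rw [← theta_add_castMat hdet hL hform f _ _ p.1 p.2 q.1 q.2]
    have h1 : pairMul ((toReal (⟨1, q⟩ : JacobiGroup m n ℤ)).vec + p)
        (toReal (⟨1, q⟩ : JacobiGroup m n ℤ)).sl⁻¹ =
        (p.1 + castMat q.1, p.2 + castMat q.2) := by
      ext i j <;> simp [toReal, pairMul, add_comm]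
    have h2 : (toReal (⟨1, q⟩ : JacobiGroup m n ℤ) * x).sl = x.sl := by
      simp [mul_def, toReal]
    rw [h1, h2]

end group

end

end ThetaSum

theorem theorem3p4 (m n : ℕ) (hm : 0 < m) (hn : 0 < n)
    (M : Matrix (Fin m) (Fin m) ℤ) (hsymm : M.IsSymm)
    (hpos : (M.map (Int.cast : ℤ → ℝ)).PosDef) (huni : IsUnit M.det)
    (hM : Set.range (fun X : Matrix (Fin m) (Fin n) ℤ => M * X) = Set.univ)
    (f g : 𝓢(Matrix (Fin m) (Fin n) ℝ, ℂ)) :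
    (∀ (τ : ℍ) (φ : ℝ) (lam mu : Matrix (Fin m) (Fin n) ℝ),
      Summable (ThetaSum.thetaTerm (M.map (Int.cast : ℤ → ℝ)) f τ φ lam mu) ∧
      Summable (ThetaSum.thetaTerm (M.map (Int.cast : ℤ → ℝ)) g τ φ lam mu)) ∧
    ∀ γ ∈ ThetaSum.Gamma2 m n, ∀ x : ThetaSum.JacobiGroup m n ℝ,
      ThetaSum.thetaFun (M.map (Int.cast : ℤ → ℝ)) f (ThetaSum.toReal γ * x) *
          (starRingEnd ℂ)
            (ThetaSum.thetaFun (M.map (Int.cast : ℤ → ℝ)) g (ThetaSum.toReal γ * x)) =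
        ThetaSum.thetaFun (M.map (Int.cast : ℤ → ℝ)) f x *
          (starRingEnd ℂ) (ThetaSum.thetaFun (M.map (Int.cast : ℤ → ℝ)) g x) := by
  refine ⟨fun τ φ lam mu => ?_, fun γ hγ x => ?_⟩
  · have hdet := ThetaSum.det_map_intCast_eq_one hpos huni
    obtain ⟨L, hL, hform⟩ := ThetaSum.exists_isometry n hpos hdet
    exact ⟨ThetaSum.summable_thetaTerm hdet hL hform f τ φ lam mu,
      ThetaSum.summable_thetaTerm hdet hL hform g τ φ lam mu⟩
  · obtain ⟨c, hc, hcf⟩ := ThetaSum.hasPhase_of_mem_Gamma2 hsymm hpos huni hγ x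
    have hcc : c * (starRingEnd ℂ) c = 1 := by
      rw [Complex.mul_conj', hc]
      norm_num
    rw [hcf f, hcf g, map_mul]
    linear_combination (ThetaSum.thetaFun (M.map (Int.cast : ℤ → ℝ)) f x *
      (starRingEnd ℂ) (ThetaSum.thetaFun (M.map (Int.cast : ℤ → ℝ)) g x)) * hcc
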